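/- Let $p\ge 2$, let $\mathfrak g=\mathrm{so}_{p+2}$ be the Lie algebra of skew-symmetric complex $(p+2)\times(p+2)$ matrices, let $\theta(X)=J_{p,2}XJ_{p,2}$ with $J_{p,2}=\mathrm{diag}(I_p,-I_2)$, and let $\mathfrak g=\mathfrak k\oplus\mathfrak p$ be the decomposition into the $+1$ and $-1$ eigenspaces of $\theta$, so that $(\mathfrak g,\mathfrak k)=(\mathrm{so}_{p+2},\mathrm{so}_p\times\mathrm{so}_2)$. For $X\in\mathfrak p$ let $\mathfrak g^X$ be the centralizer of $X$ in $\mathfrak g$, $\mathfrak p^X=\mathfrak p\cap\mathfrak g^X$, $\mathfrak l=[\mathfrak g^X,\mathfrak g^X]$, $\mathfrak l_-=\mathfrak l\cap\mathfrak p^X$, $\mathfrak r_+=[\mathfrak l_-,\mathfrak l_-]$ and $\mathfrak r=\mathfrak r_+\oplus\mathfrak l_-$, a Lie subalgebra of $\mathfrak g$. Call $X\in\mathfrak p$ $\mathfrak p$-regular if $\dim\mathfrak p^X\le\dim\mathfrak p^Y$ for all $Y\in\mathfrak p$. Then for every nonzero semisimple element $X$ of $\mathfrak g$ (that is, $\mathrm{ad}\,X$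 is diagonalizable) which lies in $\mathfrak p$ and is not $\mathfrak p$-regular, the symmetric pair $(\mathfrak r,\mathfrak r_+)$ is of the form $(\mathrm{so}_{m+1},\mathrm{so}_m)$ for some $m\in\mathbb N$: there is an isomorphism of complex Lie algebras $\mathfrak r\to\mathrm{so}_{m+1}$ under which $\mathfrak r_+$ and $\mathfrak l_-$ correspond to the $+1$ and the $-1$ eigenspace of the involution $Y\mapsto J_{m,1}YJ_{m,1}$ of $\mathrm{so}_{m+1}$, where $J_{m,1}=\mathrm{diag}(I_m,-1)$; in particular $\mathfrak r_+$ corresponds to $\mathrm{so}_m$. -/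

import Mathlib

attribute [local instance 100] LieRing.ofAssociativeRing

namespace SymPair

section General

variable {L : Type*} [LieRing L] [LieAlgebra ℂ L]

/-- `𝔨 = {x | θ x = x}`, for an (involutive) endomorphism `θ` of a complex Lie algebra. -/
def kPart (θ : L →ₗ⁅ℂ⁆ L) : LieSubalgebra ℂ L where
  carrier := {x | θ x = x}
  add_mem' := by
    intro a b ha hb
    simp only [Set.mem_ofPred_eq] at *
    rw [map_add, ha, hb]
  zero_mem' := map_zero θ
  smul_mem' := by
    intro c x hx
    simp only [Set.mem_ofPred_eq] at *
    rw [map_smul, hx]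
  lie_mem' := by
    intro x y hx hy
    change θ x = x at hx
    change θ y = y at hy
    change θ ⁅x, y⁆ = ⁅x, y⁆
    rw [LieHom.map_lie, hx, hy]

/-- `𝔭 = {x | θ x = -x}`. -/
def pPart (θ : L →ₗ⁅ℂ⁆ L) : Submodule ℂ L where
  carrier := {x | θ x = -x}
  add_mem' := by
    intro a b ha hb
    simp only [Set.mem_ofPred_eq] at *
    rw [map_add, ha, hb, neg_add]
  zero_mem' := by simp
  smul_mem' := by
    intro c x hx
    simp only [Set.mem_ofPred_eq] at *
    rw [map_smul, hx, smul_neg]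

/-- The centralizer `𝔤^X = {y | [X, y] = 0}`. -/
def cent (X : L) : LieSubalgebra ℂ L where
  carrier := {y | ⁅X, y⁆ = 0}
  add_mem' := by
    intro a b ha hb
    simp only [Set.mem_ofPred_eq] at *
    rw [lie_add, ha, hb, add_zero]
  zero_mem' := lie_zero X
  smul_mem' := by
    intro c x hx
    simp only [Set.mem_ofPred_eq] at *
    rw [lie_smul, hx, smul_zero]
  lie_mem' := by
    intro x y hx hy
    change ⁅X, x⁆ = 0 at hx
    change ⁅X, y⁆ = 0 at hy
    change ⁅X, ⁅x, y⁆⁆ = 0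
    rw [leibniz_lie, hx, hy, zero_lie, lie_zero, add_zero]

/-- `𝔭^X = 𝔭 ∩ 𝔤^X`. -/
def pCent (θ : L →ₗ⁅ℂ⁆ L) (X : L) : Submodule ℂ L :=
  pPart θ ⊓ (cent X).toSubmodule

/-- `X ∈ 𝔭` is `𝔭`-regular if `dim 𝔭^X` is the least possible among the elements of `𝔭`
(equivalently, its `K`-orbit in `𝔭` has the largest possible dimension). -/
def IsPRegular (θ : L →ₗ⁅ℂ⁆ L) (X : L) : Prop :=
  X ∈ pPart θ ∧
    ∀ Y ∈ pPart θ, Module.finrank ℂ (pCent θ X) ≤ Module.finrank ℂ (pCent θ Y)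

/-- `X` is a semisimple element: `ad X` is a semisimple (diagonalizable) endomorphism. -/
def IsSemisimpleElement (X : L) : Prop :=
  (LieAlgebra.ad ℂ L X).IsSemisimple

/-- `[V, W]`: the linear span of all brackets `[v, w]`, `v ∈ V`, `w ∈ W`. -/
def bracketSpan (V W : Submodule ℂ L) : Submodule ℂ L :=
  Submodule.span ℂ {z | ∃ v ∈ V, ∃ w ∈ W, ⁅v, w⁆ = z}

/-- `𝔩 = [𝔤^X, 𝔤^X]`. -/
def lPart (X : L) : Submodule ℂ L :=
  bracketSpan (cent X).toSubmodule (cent X).toSubmodule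

/-- `𝔩₋ = 𝔩 ∩ 𝔭^X`. -/
def lMinus (θ : L →ₗ⁅ℂ⁆ L) (X : L) : Submodule ℂ L :=
  lPart X ⊓ pCent θ X

/-- `𝔯₊ = [𝔩₋, 𝔩₋]`. -/
def rPlus (θ : L →ₗ⁅ℂ⁆ L) (X : L) : Submodule ℂ L :=
  bracketSpan (lMinus θ X) (lMinus θ X)

theorem lie_mem_bracketSpan {V W : Submodule ℂ L} {v w : L} (hv : v ∈ V) (hw : w ∈ W) :
    ⁅v, w⁆ ∈ bracketSpan V W :=
  Submodule.subset_span ⟨v, hv, w, hw, rfl⟩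

theorem bracketSpan_le {V W U : Submodule ℂ L} (h : ∀ v ∈ V, ∀ w ∈ W, ⁅v, w⁆ ∈ U) :
    bracketSpan V W ≤ U := by
  refine Submodule.span_le.2 ?_
  rintro _ ⟨v, hv, w, hw, rfl⟩
  exact h v hv w hw

theorem lPart_le_cent (X : L) : lPart X ≤ (cent X).toSubmodule :=
  bracketSpan_le fun _ hv _ hw => (cent X).lie_mem hv hw

theorem rPlus_le_kPart (θ : L →ₗ⁅ℂ⁆ L) (X : L) : rPlus θ X ≤ (kPart θ).toSubmodule := by
  refine bracketSpan_le fun v hv w hw => ?_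
  have h1 : θ v = -v := hv.2.1
  have h2 : θ w = -w := hw.2.1
  change θ ⁅v, w⁆ = ⁅v, w⁆
  rw [LieHom.map_lie, h1, h2, neg_lie, lie_neg, neg_neg]

/-- `[𝔯₊, 𝔩₋] ⊆ 𝔩₋`. -/
theorem lie_rPlus_lMinus (θ : L →ₗ⁅ℂ⁆ L) (X : L) {a b : L}
    (ha : a ∈ rPlus θ X) (hb : b ∈ lMinus θ X) : ⁅a, b⁆ ∈ lMinus θ X := by
  have hac : a ∈ (cent X).toSubmodule := by
    refine bracketSpan_le (fun v hv w hw => ?_) ha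
    exact (cent X).lie_mem hv.2.2 hw.2.2
  have hak : θ a = a := rPlus_le_kPart θ X ha
  have hbp : θ b = -b := hb.2.1
  refine ⟨lie_mem_bracketSpan hac hb.2.2, ?_, (cent X).lie_mem hac hb.2.2⟩
  change θ ⁅a, b⁆ = -⁅a, b⁆
  rw [LieHom.map_lie, hak, hbp, lie_neg]

/-- `[𝔯₊, 𝔯₊] ⊆ 𝔯₊`. -/
theorem lie_rPlus_rPlus (θ : L →ₗ⁅ℂ⁆ L) (X : L) {a b : L}
    (ha : a ∈ rPlus θ X) (hb : b ∈ rPlus θ X) : ⁅a, b⁆ ∈ rPlus θ X := by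
  induction hb using Submodule.span_induction with
  | mem z hz =>
    obtain ⟨v, hv, w, hw, rfl⟩ := hz
    rw [leibniz_lie]
    exact add_mem (lie_mem_bracketSpan (lie_rPlus_lMinus θ X ha hv) hw)
      (lie_mem_bracketSpan hv (lie_rPlus_lMinus θ X ha hw))
  | zero => rw [lie_zero]; exact zero_mem _
  | add x y _ _ hx hy => rw [lie_add]; exact add_mem hx hy
  | smul c x _ hx => rw [lie_smul]; exact Submodule.smul_mem _ c hx

/-- The Lie subalgebra `𝔯 = 𝔯₊ ⊕ 𝔩₋` of `𝔤`. -/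
def rAlg (θ : L →ₗ⁅ℂ⁆ L) (X : L) : LieSubalgebra ℂ L where
  toSubmodule := rPlus θ X ⊔ lMinus θ X
  lie_mem' := by
    intro x y hx hy
    obtain ⟨a, ha, b, hb, rfl⟩ := Submodule.mem_sup.1 hx
    obtain ⟨c, hc, d, hd, rfl⟩ := Submodule.mem_sup.1 hy
    change ⁅a + b, c + d⁆ ∈ rPlus θ X ⊔ lMinus θ X
    rw [add_lie, lie_add, lie_add]
    refine add_mem (add_mem ?_ ?_) (add_mem ?_ ?_)
    · exact Submodule.mem_sup_left (lie_rPlus_rPlus θ X ha hc)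
    · exact Submodule.mem_sup_right (lie_rPlus_lMinus θ X ha hd)
    · rw [← lie_skew]
      exact Submodule.mem_sup_right (neg_mem (lie_rPlus_lMinus θ X hc hb))
    · exact Submodule.mem_sup_left (lie_mem_bracketSpan hb hd)

end General

section Orthogonal

open LieAlgebra.Orthogonal

/-- `so_{p+q}(ℂ)`: skew-symmetric complex matrices, with rows and columns indexed by
`Fin p ⊕ Fin q`. -/
abbrev soC (p q : ℕ) : LieSubalgebra ℂ (Matrix (Fin p ⊕ Fin q) (Fin p ⊕ Fin q) ℂ) :=
  so (Fin p ⊕ Fin q) ℂ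

/-- `J_{p,q} = diag(I_p, -I_q)`. -/
abbrev J (p q : ℕ) : Matrix (Fin p ⊕ Fin q) (Fin p ⊕ Fin q) ℂ :=
  indefiniteDiagonal (Fin p) (Fin q) ℂ

theorem J_mul_J (p q : ℕ) : J p q * J p q = 1 := by
  rw [J, indefiniteDiagonal, Matrix.diagonal_mul_diagonal, ← Matrix.diagonal_one]
  congr 1
  ext i
  rcases i with i | i <;> simp

theorem J_transpose (p q : ℕ) : (J p q).transpose = J p q :=
  Matrix.diagonal_transpose _

/-- The involution `X ↦ J_{p,q} X J_{p,q}` of `so_{p+q}(ℂ)`; it defines the symmetric pair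
`(so_{p+q}, so_p × so_q)`, and for `q = 1` the pair `(so_{p+1}, so_p)`. -/
def soInv (p q : ℕ) : soC p q →ₗ⁅ℂ⁆ soC p q where
  toFun X := ⟨J p q * X.1 * J p q, by
    have h := (mem_so _ _ _).1 X.2
    rw [mem_so, Matrix.transpose_mul, Matrix.transpose_mul, J_transpose, h, Matrix.neg_mul,
      Matrix.mul_neg, Matrix.mul_assoc]⟩
  map_add' X Y := by
    apply Subtype.ext
    simp [Matrix.mul_add, Matrix.add_mul]
  map_smul' c X := by
    apply Subtype.ext
    simp
  map_lie' := by
    intro X Y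
    apply Subtype.ext
    have key : ∀ A B : Matrix (Fin p ⊕ Fin q) (Fin p ⊕ Fin q) ℂ,
        J p q * A * J p q * (J p q * B * J p q) = J p q * (A * B) * J p q := by
      intro A B
      calc J p q * A * J p q * (J p q * B * J p q)
          = J p q * A * (J p q * J p q) * B * J p q := by simp only [Matrix.mul_assoc]
        _ = J p q * (A * B) * J p q := by
          rw [J_mul_J, Matrix.mul_one]; simp only [Matrix.mul_assoc]
    simp only [LieSubalgebra.coe_bracket, LieRing.of_associative_ring_bracket]
    rw [key, key, Matrix.mul_sub, Matrix.sub_mul]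

theorem soInv_soInv (p q : ℕ) (X : soC p q) : soInv p q (soInv p q X) = X := by
  apply Subtype.ext
  change J p q * (J p q * X.1 * J p q) * J p q = X.1
  calc J p q * (J p q * X.1 * J p q) * J p q
      = (J p q * J p q) * X.1 * (J p q * J p q) := by simp only [Matrix.mul_assoc]
    _ = X.1 := by rw [J_mul_J, Matrix.one_mul, Matrix.mul_one]

end Orthogonal

end SymPair

/-! Write an element of `𝔭` as `X = (0, A; -Aᵀ, 0)` with a `p × 2` block `A`.

The adjoint action of `X` on `so_{p+2}` being semisimple, so is the matrix `X`: its Jordan components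
are again skew-symmetric, and a nilpotent one acting semisimply is central, hence zero
(`isSemisimple_toLin'_of_ad`). Therefore the Gram matrix `AᵀA` is semisimple with the same kernel as
`A`. A semisimple complex symmetric `2 × 2` matrix is diagonalised by an orthogonal one, and complex
reflections then move the columns of `A` into the first two coordinate axes. So up to conjugation by
`O_p × O_2`, which affects neither side of the claim, `X = d₀ e₁ ∧ f₁ + d₁ e₂ ∧ f₂`
(`exists_normal_form`), and `d₀ ≠ 0` can be assumed.

Since `[𝔭, 𝔭] = so_m` in the pair `(so_{m+1}, so_m)`, it is enough to find an injective homomorphism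
`so_{m+1} → so_{p+2}` which maps the `-1` eigenspace onto `𝔩₋` (`HasModel.exists_equiv`). The
centralizer of the normal form is read off from matrix entries, and there are three cases.

* `d₁ = 0` and `p ≥ 3` (`hasModel_of_eq_zero`): `𝔤^X = so_2 × so_p`, so `𝔩 = so_p` is a coordinate
  block, and `m = p - 1`.
* `d₀ = d₁`, the case `d₀ = -d₁` having been absorbed into it (`hasModel_of_eq`): `𝔤^X` is
  `gl_2 × so_{p-2}`, and `𝔩₋` lies in the factor `sl_2 = so_3` of `𝔩`, so that `m = 2`.
* Otherwise (`hasModel_of_sq_ne`) `𝔤^X` preserves the planes spanned by `e_k` and `f_k`, hence `𝔩`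
  acts trivially on them; so `𝔩₋ = 0` and `m = 0`. -/

namespace SymPair

open Matrix LieAlgebra.Orthogonal

/-! ### Semisimple elements of `so_n` are semisimple matrices -/

/-- Semisimplicity passes to a subrepresentation: the minimal polynomial of the bigger endomorphism
is squarefree and annihilates the smaller one. -/
theorem isSemisimple_of_injective_intertwining {K V W : Type*} [Field K] [AddCommGroup V]
    [Module K V] [AddCommGroup W] [Module K W] [FiniteDimensional K W]
    {f : Module.End K V} {g : Module.End K W} (i : V →ₗ[K] W) (hi : Function.Injective i)
    (h : ∀ v, i (f v) = g (i v)) (hg : g.IsSemisimple) : f.IsSemisimple := by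
  refine Module.End.isSemisimple_of_squarefree_aeval_eq_zero hg.minpoly_squarefree ?_
  have key : ∀ (q : Polynomial K) (v : V),
      i (Polynomial.aeval f q v) = Polynomial.aeval g q (i v) := by
    intro q
    induction q using Polynomial.induction_on with
    | C a => intro v; simp [Polynomial.aeval_C, Module.algebraMap_end_apply]
    | add p q hp hq => intro v; simp [hp, hq]
    | monomial n a ih =>
      intro v
      have h1 : ∀ F : Module.End K V, Polynomial.aeval F
          (Polynomial.C a * Polynomial.X ^ n * Polynomial.X) =
          Polynomial.aeval F (Polynomial.C a * Polynomial.X ^ n) * F := fun F => by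
        rw [map_mul, Polynomial.aeval_X]
      have h2 : ∀ F : Module.End K W, Polynomial.aeval F
          (Polynomial.C a * Polynomial.X ^ n * Polynomial.X) =
          Polynomial.aeval F (Polynomial.C a * Polynomial.X ^ n) * F := fun F => by
        rw [map_mul, Polynomial.aeval_X]
      rw [pow_succ, ← mul_assoc, h1, h2, Module.End.mul_apply, Module.End.mul_apply, ih, h]
  ext v
  apply hi
  rw [key, minpoly.aeval]
  simp

theorem isSemisimple_toLin'_transpose {ι : Type*} [Fintype ι] [DecidableEq ι] {A : Matrix ι ι ℂ}
    (hA : Module.End.IsSemisimple (toLin' A)) : Module.End.IsSemisimple (toLin' Aᵀ) := by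
  refine Module.End.isSemisimple_of_squarefree_aeval_eq_zero hA.minpoly_squarefree ?_
  have h1 : ∀ (B : Matrix ι ι ℂ) (q : Polynomial ℂ),
      Polynomial.aeval (toLin' B) q = toLin' (Polynomial.aeval B q) := fun B q =>
    Polynomial.aeval_algHom_apply (toLinAlgEquiv' (R := ℂ) (n := ι)) B q
  have h2 : ∀ (q : Polynomial ℂ), Polynomial.aeval Aᵀ q = (Polynomial.aeval A q)ᵀ := by
    intro q
    induction q using Polynomial.induction_on with
    | C a => simp [Polynomial.aeval_C, algebraMap_eq_diagonal]
    | add p q hp hq => simp [hp, hq]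
    | monomial n a ih =>
      have h3 : Polynomial.aeval A (Polynomial.C a * Polynomial.X ^ n * Polynomial.X) =
          A * Polynomial.aeval A (Polynomial.C a * Polynomial.X ^ n) := by
        rw [mul_comm, map_mul, Polynomial.aeval_X]
      rw [pow_succ, ← mul_assoc, h3, map_mul, ih, Polynomial.aeval_X, transpose_mul]
  have h3 := minpoly.aeval ℂ (toLin' A)
  rw [h1] at h3 ⊢
  rw [h2, (LinearEquiv.map_eq_zero_iff _).1 h3]
  simp

/-- For `n ≥ 3` the centre of `so_n` is zero. -/
theorem eq_zero_of_commute_so {ι : Type*} [Fintype ι] [DecidableEq ι] (hι : 2 < Fintype.card ι)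
    {N : Matrix ι ι ℂ} (hN : Nᵀ = -N) (h : ∀ Y ∈ so ι ℂ, N * Y = Y * N) : N = 0 := by
  have hskew : ∀ i j, N j i = -N i j := fun i j => congrFun (congrFun hN i) j
  ext k i
  by_cases hki : k = i
  · subst hki
    have := hskew k k
    simpa using self_eq_neg.1 this
  obtain ⟨j, hj⟩ : ∃ j, j ∉ ({k, i} : Finset ι) := by
    by_contra! hcon
    have h1 : (Finset.univ : Finset ι) ⊆ {k, i} := fun j _ => hcon j
    have := (Finset.card_le_card h1).trans Finset.card_le_two
    rw [Finset.card_univ] at this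
    omega
  simp only [Finset.mem_insert, Finset.mem_singleton, not_or] at hj
  have := h (single i j 1 - single j i 1) (by
    rw [mem_so, transpose_sub, transpose_single, transpose_single, neg_sub])
  have := congrFun (congrFun this k) j
  rw [Matrix.mul_sub, Matrix.sub_mul] at this
  simpa [Matrix.sub_apply, hj, hki, Ne.symm hj.1, Ne.symm hj.2] using this

/-- A skew-symmetric matrix of size at least `3` whose adjoint action on `so_n` is semisimple is
itself semisimple. Both parts of its Jordan decomposition are skew-symmetric, by uniqueness; the
nilpotent part acts on `so_n` both nilpotently and semisimply, hence is central, hence zero. -/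
theorem isSemisimple_toLin'_of_ad {ι : Type*} [Fintype ι] [DecidableEq ι]
    (hι : 2 < Fintype.card ι) (X : so ι ℂ)
    (hX : (LieAlgebra.ad ℂ (so ι ℂ) X).IsSemisimple) :
    Module.End.IsSemisimple (toLin' X.1) := by
  obtain ⟨n, hn, s, hs, hnil, hss, hsum⟩ :=
    Module.End.exists_isNilpotent_isSemisimple (f := toLin' X.1)
  have hcomm : Commute n s :=
    (Algebra.commute_of_mem_adjoin_singleton_of_commute hs
      (Algebra.commute_of_mem_adjoin_self hn).symm)
  obtain ⟨N, rfl⟩ := (toLin' (R := ℂ) (n := ι) (m := ι)).surjective n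
  obtain ⟨S, rfl⟩ := (toLin' (R := ℂ) (n := ι) (m := ι)).surjective s
  have hmul : ∀ A B : Matrix ι ι ℂ, toLin' A * toLin' B = toLin' (A * B) := fun A B =>
    (toLin'_mul A B).symm
  have hNS : N * S = S * N := by
    have : toLin' (N * S) = toLin' (S * N) := by rw [← hmul, ← hmul]; exact hcomm
    exact toLin'.injective this
  have hXNS : X.1 = N + S := toLin'.injective (by rw [map_add]; exact hsum)
  have hskew : (X.1)ᵀ = -X.1 := (mem_so _ _ _).1 X.2
  have hNnil : IsNilpotent N := by
    obtain ⟨k, hk⟩ := hnil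
    refine ⟨k, toLin'.injective ?_⟩
    have : toLin' (N ^ k) = (toLin' N) ^ k := map_pow (toLinAlgEquiv' (R := ℂ) (n := ι)) N k
    rw [this, hk, map_zero]
  have hNnil' : IsNilpotent (toLin' (-Nᵀ)) := by
    obtain ⟨k, hk⟩ := hNnil
    refine ⟨k, ?_⟩
    have : toLin' ((-Nᵀ) ^ k) = (toLin' (-Nᵀ)) ^ k :=
      map_pow (toLinAlgEquiv' (R := ℂ) (n := ι)) (-Nᵀ) k
    rw [← this, neg_pow, ← transpose_pow, hk]
    simp
  have hSss' : Module.End.IsSemisimple (toLin' (-Sᵀ)) := by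
    rw [map_neg, Module.End.isSemisimple_neg]
    exact isSemisimple_toLin'_transpose hss
  have hcomm' : Commute (toLin' (-Nᵀ)) (toLin' (-Sᵀ)) := by
    change _ * _ = _ * _
    rw [hmul, hmul, neg_mul_neg, neg_mul_neg, ← transpose_mul, ← transpose_mul, hNS]
  obtain ⟨hN1, hS1⟩ := Module.End.isNilpotent_isSemisimple_unique hnil hss hNnil' hSss' hcomm hcomm'
    (by
      rw [← map_add, ← map_add, ← neg_add, ← transpose_add, ← hXNS, hskew, neg_neg])
  have hNT : Nᵀ = -N := by rw [toLin'.injective hN1, neg_neg, ← toLin'.injective hN1]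
  have hST : Sᵀ = -S := by rw [toLin'.injective hS1, neg_neg, ← toLin'.injective hS1]
  let NL : so ι ℂ := ⟨N, (mem_so _ _ _).2 hNT⟩
  let SL : so ι ℂ := ⟨S, (mem_so _ _ _).2 hST⟩
  have hX' : X = NL + SL := Subtype.ext hXNS
  have hadN : IsNilpotent (LieAlgebra.ad ℂ (so ι ℂ) NL) :=
    LieAlgebra.isNilpotent_ad_of_isNilpotent hNnil
  let i : so ι ℂ →ₗ[ℂ] Module.End ℂ (ι → ℂ) :=
    (toLin' (R := ℂ) (n := ι) (m := ι)).toLinearMap ∘ₗ (so ι ℂ).toSubmodule.subtype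
  have hadS : (LieAlgebra.ad ℂ (so ι ℂ) SL).IsSemisimple := by
    refine isSemisimple_of_injective_intertwining i ?_ ?_
      (LieAlgebra.ad_isSemisimple_of_isSemisimple (K := ℂ) hss)
    · exact (toLin' (R := ℂ) (n := ι) (m := ι)).injective.comp Subtype.val_injective
    · intro Y
      change toLin' (S * Y.1 - Y.1 * S) = toLin' S * toLin' Y.1 - toLin' Y.1 * toLin' S
      rw [map_sub, hmul, hmul]
  have hNSL : ⁅NL, SL⁆ = 0 := Subtype.ext (sub_eq_zero.2 hNS)
  have hadcomm : Commute (LieAlgebra.ad ℂ (so ι ℂ) X) (LieAlgebra.ad ℂ (so ι ℂ) SL) := by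
    rw [Commute, SemiconjBy, ← sub_eq_zero, ← Ring.lie_def, ← LieHom.map_lie, hX', add_lie, hNSL,
      lie_self, add_zero, map_zero]
  have hadN' : (LieAlgebra.ad ℂ (so ι ℂ) NL).IsSemisimple := by
    have : LieAlgebra.ad ℂ (so ι ℂ) NL =
        LieAlgebra.ad ℂ (so ι ℂ) X - LieAlgebra.ad ℂ (so ι ℂ) SL := by
      rw [hX', map_add, add_sub_cancel_right]
    rw [this]
    exact hX.sub_of_commute hadcomm hadS
  have had0 := Module.End.eq_zero_of_isNilpotent_isSemisimple hadN hadN'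
  have hN0 : N = 0 := by
    refine eq_zero_of_commute_so hι hNT fun Y hY => ?_
    have := congrArg Subtype.val (LinearMap.congr_fun had0 ⟨Y, hY⟩)
    exact sub_eq_zero.1 this
  rw [hXNS, hN0, zero_add]
  exact hss

/-! ### Homomorphisms and the subspaces `𝔩₋`, `𝔯₊` -/

section General

variable {L M : Type*} [LieRing L] [LieAlgebra ℂ L] [LieRing M] [LieAlgebra ℂ M]

theorem map_bracketSpan (f : L →ₗ⁅ℂ⁆ M) (V W : Submodule ℂ L) :
    (bracketSpan V W).map (f : L →ₗ[ℂ] M) =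
      bracketSpan (V.map (f : L →ₗ[ℂ] M)) (W.map (f : L →ₗ[ℂ] M)) := by
  apply le_antisymm
  · rw [Submodule.map_le_iff_le_comap]
    refine bracketSpan_le fun v hv w hw => ?_
    rw [Submodule.mem_comap, LieHom.coe_toLinearMap, LieHom.map_lie]
    exact lie_mem_bracketSpan (Submodule.mem_map_of_mem hv) (Submodule.mem_map_of_mem hw)
  · refine bracketSpan_le ?_
    rintro _ ⟨v, hv, rfl⟩ _ ⟨w, hw, rfl⟩
    exact ⟨⁅v, w⁆, lie_mem_bracketSpan hv hw, f.map_lie v w⟩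

theorem bracketSpan_mono {V V' W W' : Submodule ℂ L} (hV : V ≤ V') (hW : W ≤ W') :
    bracketSpan V W ≤ bracketSpan V' W' :=
  bracketSpan_le fun _ hv _ hw => lie_mem_bracketSpan (hV hv) (hW hw)

theorem apply_mem_lMinus {θ : L →ₗ⁅ℂ⁆ L} {θ' : M →ₗ⁅ℂ⁆ M} (f : L →ₗ⁅ℂ⁆ M)
    (hf : ∀ Y, θ' (f Y) = f (θ Y)) {X Y : L} (hY : Y ∈ lMinus θ X) : f Y ∈ lMinus θ' (f X) := by
  have hcent : (cent X).toSubmodule.map (f : L →ₗ[ℂ] M) ≤ (cent (f X)).toSubmodule := by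
    rintro _ ⟨Z, hZ, rfl⟩
    change ⁅f X, f Z⁆ = 0
    rw [← LieHom.map_lie, show ⁅X, Z⁆ = 0 from hZ, map_zero]
  refine ⟨?_, ?_, hcent (Submodule.mem_map_of_mem hY.2.2)⟩
  · refine bracketSpan_mono hcent hcent ?_
    rw [← map_bracketSpan]
    exact Submodule.mem_map_of_mem hY.1
  · change θ' (f Y) = -f Y
    rw [hf, show θ Y = -Y from hY.2.1, map_neg]

/-- A homomorphism into `𝔤^X` that intertwines the involutions maps the `-1` eigenspace into `𝔩₋`,
provided that this eigenspace consists of sums of brackets. -/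
theorem map_pPart_le_lMinus {θ : L →ₗ⁅ℂ⁆ L} {θ' : M →ₗ⁅ℂ⁆ M} (f : L →ₗ⁅ℂ⁆ M)
    (hf : ∀ Y, θ' (f Y) = f (θ Y)) {X : M} (hX : ∀ Y, ⁅X, f Y⁆ = 0)
    (hperf : pPart θ ≤ bracketSpan ⊤ ⊤) :
    (pPart θ).map (f : L →ₗ[ℂ] M) ≤ lMinus θ' X := by
  have htop : (⊤ : Submodule ℂ L).map (f : L →ₗ[ℂ] M) ≤ (cent X).toSubmodule := by
    rintro _ ⟨Y, -, rfl⟩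
    exact hX Y
  rintro _ ⟨Y, hY, rfl⟩
  refine ⟨?_, ?_, hX Y⟩
  · refine bracketSpan_mono htop htop ?_
    rw [← map_bracketSpan]
    exact Submodule.mem_map_of_mem (hperf hY)
  · change θ' (f Y) = -f Y
    rw [hf, show θ Y = -Y from hY, map_neg]

theorem kPart_sup_pPart {θ : L →ₗ⁅ℂ⁆ L} (hθ : ∀ Y, θ (θ Y) = Y) :
    (kPart θ).toSubmodule ⊔ pPart θ = ⊤ := by
  refine eq_top_iff.2 fun Y _ => ?_
  have h : Y = (2⁻¹ : ℂ) • (Y + θ Y) + (2⁻¹ : ℂ) • (Y - θ Y) := by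
    rw [← smul_add, add_add_sub_cancel, ← two_smul ℂ Y, smul_smul]
    norm_num
  rw [h]
  refine Submodule.add_mem_sup (Submodule.smul_mem _ _ ?_) (Submodule.smul_mem _ _ ?_)
  · change θ (Y + θ Y) = Y + θ Y
    rw [map_add, hθ, add_comm]
  · change θ (Y - θ Y) = -(Y - θ Y)
    rw [map_sub, hθ, neg_sub]

end General

/-! ### The symmetric pair `(so_{m+1}, so_m)` -/

/-- The basis vector `E_{i,m+1} - E_{m+1,i}` of the `-1` eigenspace of the pair
`(so_{m+1}, so_m)`. -/
def pBasis {m : ℕ} (i : Fin m) : soC m 1 :=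
  ⟨single (Sum.inl i) (Sum.inr 0) 1 - single (Sum.inr 0) (Sum.inl i) 1, by
    rw [mem_so, transpose_sub, transpose_single, transpose_single, neg_sub]⟩

theorem soInv_apply_apply {p q : ℕ} (Y : soC p q) (i j : Fin p ⊕ Fin q) :
    (soInv p q Y).1 i j =
      Sum.elim (fun _ => 1) (fun _ => -1) i * Y.1 i j * Sum.elim (fun _ => 1) (fun _ => -1) j := by
  change (diagonal (Sum.elim (fun _ => 1) (fun _ => -1)) * Y.1 *
    diagonal (Sum.elim (fun _ => 1) (fun _ => -1)) : Matrix (Fin p ⊕ Fin q) _ ℂ) i j = _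
  rw [mul_diagonal, diagonal_mul]

theorem soC_apply_swap {p q : ℕ} (Y : soC p q) (i j : Fin p ⊕ Fin q) : Y.1 j i = -Y.1 i j :=
  congrFun (congrFun ((mem_so _ _ _).1 Y.2) i) j

theorem soC_apply_self {p q : ℕ} (Y : soC p q) (i : Fin p ⊕ Fin q) : Y.1 i i = 0 :=
  self_eq_neg.1 (soC_apply_swap Y i i)

theorem mem_pPart_soInv {p q : ℕ} {Y : soC p q} :
    Y ∈ pPart (soInv p q) ↔
      (∀ i j, Y.1 (Sum.inl i) (Sum.inl j) = 0) ∧ ∀ i j, Y.1 (Sum.inr i) (Sum.inr j) = 0 := by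
  have h : Y ∈ pPart (soInv p q) ↔ ∀ i j, (soInv p q Y).1 i j = -Y.1 i j := by
    change soInv p q Y = -Y ↔ _
    rw [← Subtype.coe_inj, ← Matrix.ext_iff]
    rfl
  rw [h]
  simp [soInv_apply_apply, Sum.forall, self_eq_neg, neg_eq_self]

theorem mem_kPart_soInv {p q : ℕ} {Y : soC p q} :
    Y ∈ kPart (soInv p q) ↔ ∀ i j, Y.1 (Sum.inl i) (Sum.inr j) = 0 := by
  have h : Y ∈ kPart (soInv p q) ↔ ∀ i j, (soInv p q Y).1 i j = Y.1 i j := by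
    change soInv p q Y = Y ↔ _
    rw [← Subtype.coe_inj, ← Matrix.ext_iff]
  rw [h]
  simp only [soInv_apply_apply, Sum.forall, Sum.elim_inl, Sum.elim_inr, one_mul, mul_one,
    mul_neg, neg_mul, neg_neg, neg_eq_self, forall_true_iff, true_and, and_true]
  exact ⟨fun h => h.1, fun h => ⟨h, fun i j => by rw [soC_apply_swap Y (Sum.inl j), h, neg_zero]⟩⟩

theorem pBasis_mem_pPart {m : ℕ} (i : Fin m) : pBasis i ∈ pPart (soInv m 1) := by
  rw [mem_pPart_soInv]
  constructor <;> intros <;> simp [pBasis]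

theorem lie_pBasis {m : ℕ} (i j : Fin m) :
    (⁅pBasis i, pBasis j⁆ : soC m 1).1 =
      single (Sum.inl j) (Sum.inl i) 1 - single (Sum.inl i) (Sum.inl j) 1 := by
  change (pBasis i).1 * (pBasis j).1 - (pBasis j).1 * (pBasis i).1 = _
  by_cases h : i = j
  · subst h; simp
  · simp [pBasis, Matrix.sub_mul, Matrix.mul_sub, h, Ne.symm h]
    abel

theorem sum_smul_pBasis {m : ℕ} {Y : soC m 1} (hY : Y ∈ pPart (soInv m 1)) :
    Y = ∑ i, Y.1 (Sum.inl i) (Sum.inr 0) • pBasis i := by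
  rw [mem_pPart_soInv] at hY
  apply Subtype.ext
  rw [AddSubmonoidClass.coe_finsetSum]
  ext i j
  rw [Matrix.sum_apply]
  rcases i with i | i <;> rcases j with j | j
  · simp [hY.1, pBasis]
  · obtain rfl := Subsingleton.elim j 0
    simp [pBasis, single_apply]
  · obtain rfl := Subsingleton.elim i 0
    rw [soC_apply_swap Y (Sum.inl j)]
    simp [pBasis, single_apply]
  · simp [hY.2, pBasis]

theorem kPart_eq_bracketSpan_pPart (m : ℕ) :
    (kPart (soInv m 1)).toSubmodule =
      bracketSpan (pPart (soInv m 1)) (pPart (soInv m 1)) := by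
  apply le_antisymm
  · intro Y hY
    have hY' := mem_kPart_soInv.1 hY
    have h : Y = ∑ i : Fin m, ∑ j : Fin m,
        (-2⁻¹ * Y.1 (Sum.inl i) (Sum.inl j)) • ⁅pBasis i, pBasis j⁆ := by
      apply Subtype.ext
      simp only [AddSubmonoidClass.coe_finsetSum, SetLike.val_smul]
      simp only [lie_pBasis]
      ext i j
      simp only [Matrix.sum_apply, Matrix.smul_apply]
      rcases i with i | i <;> rcases j with j | j
      · have := soC_apply_swap Y (Sum.inl i) (Sum.inl j)
        simp [single_apply, mul_sub, Finset.sum_sub_distrib, this, ite_and]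
        ring
      · simp [hY']
      · rw [soC_apply_swap Y (Sum.inl j), hY']
        simp
      · obtain rfl := Subsingleton.elim i j
        simp [soC_apply_self]
    rw [h]
    exact Submodule.sum_mem _ fun i _ => Submodule.sum_mem _ fun j _ => Submodule.smul_mem _ _
      (lie_mem_bracketSpan (pBasis_mem_pPart i) (pBasis_mem_pPart j))
  · refine bracketSpan_le fun v hv w hw => ?_
    change soInv m 1 ⁅v, w⁆ = ⁅v, w⁆
    rw [LieHom.map_lie, show soInv m 1 v = -v from hv, show soInv m 1 w = -w from hw, neg_lie,
      lie_neg, neg_neg]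

theorem pPart_le_bracketSpan_top {m : ℕ} (hm : 2 ≤ m) :
    pPart (soInv m 1) ≤ bracketSpan ⊤ ⊤ := by
  intro Y hY
  rw [sum_smul_pBasis hY]
  refine Submodule.sum_mem _ fun i _ => Submodule.smul_mem _ _ ?_
  obtain ⟨j, hj⟩ : ∃ j : Fin m, j ≠ i := by
    have : Nontrivial (Fin m) := Fin.nontrivial_iff_two_le.2 hm
    exact exists_ne i
  have h : pBasis i = ⁅pBasis j, ⁅pBasis i, pBasis j⁆⁆ := by
    apply Subtype.ext
    change _ = (pBasis j).1 * (⁅pBasis i, pBasis j⁆ : soC m 1).1 -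
      (⁅pBasis i, pBasis j⁆ : soC m 1).1 * (pBasis j).1
    rw [lie_pBasis]
    simp [pBasis, Matrix.sub_mul, Matrix.mul_sub, hj, hj.symm]
    abel
  rw [h]
  exact lie_mem_bracketSpan Submodule.mem_top Submodule.mem_top

/-! ### Embeddings of orthogonal Lie algebras -/

/-- For a matrix `U` with orthonormal columns, the embedding `Y ↦ U Y Uᵀ` of orthogonal Lie
algebras. For square `U` this is conjugation by an orthogonal matrix. -/
def soEmb {α β : Type*} [Fintype α] [Fintype β] [DecidableEq α] [DecidableEq β]
    (U : Matrix β α ℂ) (hU : Uᵀ * U = 1) : so α ℂ →ₗ⁅ℂ⁆ so β ℂ where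
  toFun Y := ⟨U * Y.1 * Uᵀ, by
    rw [mem_so, transpose_mul, transpose_mul, transpose_transpose, (mem_so _ _ _).1 Y.2]
    simp [Matrix.mul_assoc]⟩
  map_add' Y Z := Subtype.ext (by simp [Matrix.mul_add, Matrix.add_mul])
  map_smul' c Y := Subtype.ext (by simp)
  map_lie' := by
    intro Y Z
    apply Subtype.ext
    have key : ∀ A B : Matrix α α ℂ, U * A * Uᵀ * (U * B * Uᵀ) = U * (A * B) * Uᵀ := by
      intro A B
      calc U * A * Uᵀ * (U * B * Uᵀ) = U * A * (Uᵀ * U) * B * Uᵀ := by simp only [Matrix.mul_assoc]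
        _ = U * (A * B) * Uᵀ := by rw [hU, Matrix.mul_one]; simp only [Matrix.mul_assoc]
    simp only [LieSubalgebra.coe_bracket, LieRing.of_associative_ring_bracket]
    rw [key, key, Matrix.mul_sub, Matrix.sub_mul]

theorem soEmb_val {α β : Type*} [Fintype α] [Fintype β] [DecidableEq α] [DecidableEq β]
    (U : Matrix β α ℂ) (hU : Uᵀ * U = 1) (Y : so α ℂ) : (soEmb U hU Y).1 = U * Y.1 * Uᵀ := rfl

theorem soEmb_injective {α β : Type*} [Fintype α] [Fintype β] [DecidableEq α] [DecidableEq β]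
    (U : Matrix β α ℂ) (hU : Uᵀ * U = 1) : Function.Injective (soEmb U hU) := by
  intro Y Z h
  have h' : U * Y.1 * Uᵀ = U * Z.1 * Uᵀ := congrArg Subtype.val h
  have key : ∀ A : Matrix α α ℂ, Uᵀ * (U * A * Uᵀ) * U = A := by
    intro A
    calc Uᵀ * (U * A * Uᵀ) * U = (Uᵀ * U) * A * (Uᵀ * U) := by simp only [Matrix.mul_assoc]
      _ = A := by rw [hU, Matrix.one_mul, Matrix.mul_one]
  apply Subtype.ext
  rw [← key Y.1, h', key]

theorem soInv_soEmb {m r p q : ℕ} (U : Matrix (Fin p ⊕ Fin q) (Fin m ⊕ Fin r) ℂ)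
    (hU : Uᵀ * U = 1) (hJ : J p q * U = U * J m r) (Y : soC m r) :
    soInv p q (soEmb U hU Y) = soEmb U hU (soInv m r Y) := by
  apply Subtype.ext
  change J p q * (U * Y.1 * Uᵀ) * J p q = U * (J m r * Y.1 * J m r) * Uᵀ
  have hJ' : Uᵀ * J p q = J m r * Uᵀ := by
    have := congrArg transpose hJ
    rwa [transpose_mul, transpose_mul, J_transpose, J_transpose] at this
  calc J p q * (U * Y.1 * Uᵀ) * J p q = (J p q * U) * Y.1 * (Uᵀ * J p q) := by
        simp only [Matrix.mul_assoc]
    _ = U * (J m r * Y.1 * J m r) * Uᵀ := by rw [hJ, hJ']; simp only [Matrix.mul_assoc]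

/-! ### Reduction to a description of `𝔩₋` -/

/-- `𝔩₋` is the image of the `-1` eigenspace of some pair `(so_{m+1}, so_m)` under an injective
homomorphism `so_{m+1} → so_{p+2}`. -/
def HasModel {p : ℕ} (X : soC p 2) : Prop :=
  ∃ (m : ℕ) (f : soC m 1 →ₗ⁅ℂ⁆ soC p 2), Function.Injective f ∧
    (pPart (soInv m 1)).map (f : soC m 1 →ₗ[ℂ] soC p 2) = lMinus (soInv p 2) X

/-- Since `so_m = [𝔭, 𝔭]` in `(so_{m+1}, so_m)`, a model of `𝔩₋` carries `so_m` onto `𝔯₊` and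
hence identifies the whole symmetric pair. -/
theorem HasModel.exists_equiv {p : ℕ} {X : soC p 2} (h : HasModel X) :
    ∃ (m : ℕ) (e : rAlg (soInv p 2) X ≃ₗ⁅ℂ⁆ soC m 1), ∀ x : rAlg (soInv p 2) X,
      ((x : soC p 2) ∈ rPlus (soInv p 2) X ↔ e x ∈ kPart (soInv m 1)) ∧
      ((x : soC p 2) ∈ lMinus (soInv p 2) X ↔ e x ∈ pPart (soInv m 1)) := by
  obtain ⟨m, f, hf, hl⟩ := h
  have hr : (kPart (soInv m 1)).toSubmodule.map (f : soC m 1 →ₗ[ℂ] soC p 2) =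
      rPlus (soInv p 2) X := by
    rw [kPart_eq_bracketSpan_pPart, map_bracketSpan, hl, rPlus]
  have hrange : (rAlg (soInv p 2) X : Set (soC p 2)) = f.range := by
    have : (rAlg (soInv p 2) X).toSubmodule = LinearMap.range (f : soC m 1 →ₗ[ℂ] soC p 2) := by
      change rPlus (soInv p 2) X ⊔ lMinus (soInv p 2) X = _
      rw [← hr, ← hl, ← Submodule.map_sup, kPart_sup_pPart (soInv_soInv m 1), Submodule.map_top]
    ext x
    exact SetLike.ext_iff.1 this x
  let e := (LieEquiv.ofEq _ _ hrange).trans (LieEquiv.ofInjective f hf).symm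
  have he : ∀ x, f (e x) = x := fun x =>
    congrArg Subtype.val ((LieEquiv.ofInjective f hf).apply_symm_apply (LieEquiv.ofEq _ _ hrange x))
  refine ⟨m, e, fun x => ⟨?_, ?_⟩⟩
  · rw [← hr, ← he x]
    exact ⟨fun ⟨y, hy, hyx⟩ => hf hyx ▸ hy, fun h => ⟨_, h, rfl⟩⟩
  · rw [← hl, ← he x]
    exact ⟨fun ⟨y, hy, hyx⟩ => hf hyx ▸ hy, fun h => ⟨_, h, rfl⟩⟩

/-- Models are transported by conjugation with elements of `O_p × O_2`. -/
theorem HasModel.of_conj {p : ℕ} {X : soC p 2} {g : Matrix (Fin p ⊕ Fin 2) (Fin p ⊕ Fin 2) ℂ}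
    (hg : gᵀ * g = 1) (hJ : J p 2 * g = g * J p 2) (h : HasModel (soEmb g hg X)) :
    HasModel X := by
  obtain ⟨m, f, hf, hl⟩ := h
  have hg' : gᵀᵀ * gᵀ = 1 := by rw [transpose_transpose]; exact mul_eq_one_comm.1 hg
  have hJ' : J p 2 * gᵀ = gᵀ * J p 2 := by
    have := congrArg transpose hJ
    rwa [transpose_mul, transpose_mul, J_transpose, eq_comm] at this
  have hinv : ∀ Y, soEmb gᵀ hg' (soEmb g hg Y) = Y := by
    intro Y
    apply Subtype.ext
    rw [soEmb_val, soEmb_val, transpose_transpose]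
    calc gᵀ * (g * Y.1 * gᵀ) * g = (gᵀ * g) * Y.1 * (gᵀ * g) := by simp only [Matrix.mul_assoc]
      _ = Y.1 := by rw [hg, Matrix.one_mul, Matrix.mul_one]
  refine ⟨m, (soEmb gᵀ hg').comp f, (soEmb_injective _ hg').comp hf, ?_⟩
  have hcomp : (((soEmb gᵀ hg').comp f : soC m 1 →ₗ⁅ℂ⁆ soC p 2) : soC m 1 →ₗ[ℂ] soC p 2) =
      (soEmb gᵀ hg' : soC p 2 →ₗ[ℂ] soC p 2) ∘ₗ (f : soC m 1 →ₗ[ℂ] soC p 2) := rfl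
  rw [hcomp, Submodule.map_comp, hl]
  apply le_antisymm
  · rintro _ ⟨Y, hY, rfl⟩
    have := apply_mem_lMinus (soEmb gᵀ hg') (soInv_soEmb _ hg' hJ') hY
    rwa [hinv] at this
  · intro Y hY
    exact ⟨_, apply_mem_lMinus (soEmb g hg) (soInv_soEmb _ hg hJ) hY, hinv Y⟩

theorem HasModel.of_lMinus_eq_bot {p : ℕ} {X : soC p 2} (h : lMinus (soInv p 2) X = ⊥) :
    HasModel X := by
  refine ⟨0, 0, fun Y Z _ => ?_, ?_⟩
  · apply Subtype.ext
    ext i j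
    have : Subsingleton (Fin 0 ⊕ Fin 1) := ⟨by decide⟩
    obtain rfl : i = j := Subsingleton.elim i j
    rw [soC_apply_self, soC_apply_self]
  · rw [h]
    exact Submodule.map_zero _

/-! ### Complex reflections -/

/-- The reflection in the hyperplane orthogonal to a non-isotropic vector. -/
theorem exists_reflection {ι : Type*} [Fintype ι] [DecidableEq ι] {v : ι → ℂ} (hv : v ⬝ᵥ v ≠ 0) :
    ∃ H : Matrix ι ι ℂ, Hᵀ * H = 1 ∧ ∀ z, H *ᵥ z = z - (2 * (v ⬝ᵥ z) / (v ⬝ᵥ v)) • v := by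
  refine ⟨1 - (2 / (v ⬝ᵥ v)) • vecMulVec v v, ?_, fun z => ?_⟩
  · rw [transpose_sub, transpose_one, transpose_smul, transpose_vecMulVec, Matrix.sub_mul,
      Matrix.one_mul, Matrix.mul_sub, Matrix.mul_one, Matrix.smul_mul, Matrix.mul_smul,
      vecMulVec_mul_vecMulVec, smul_smul, vecMulVec_smul, smul_smul]
    have : 2 / (v ⬝ᵥ v) * (2 / (v ⬝ᵥ v)) * (v ⬝ᵥ v) = 2 / (v ⬝ᵥ v) + 2 / (v ⬝ᵥ v) := by
      field_simp
      norm_num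
    rw [this, add_smul]
    abel
  · rw [sub_mulVec, one_mulVec, smul_mulVec, vecMulVec_mulVec]
    ext i
    simp
    ring

/-- The complex orthogonal group acts transitively on the vectors of a given nonzero square, by
elements fixing the vectors orthogonal to both. One of `x ± y` is not isotropic. The reflection in
`x - y` takes `x` to `y`, the one in `x + y` takes `x` to `-y`; in the latter case the reflection
in `y` follows. -/
theorem exists_orthogonal_mulVec_eq {ι : Type*} [Fintype ι] [DecidableEq ι] {x y : ι → ℂ}
    (hxy : x ⬝ᵥ x = y ⬝ᵥ y) (hy : y ⬝ᵥ y ≠ 0) :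
    ∃ R : Matrix ι ι ℂ, Rᵀ * R = 1 ∧ R *ᵥ x = y ∧
      ∀ z, z ⬝ᵥ x = 0 → z ⬝ᵥ y = 0 → R *ᵥ z = z := by
  by_cases h : (x - y) ⬝ᵥ (x - y) = 0
  · have h' : (x + y) ⬝ᵥ (x + y) = 2 * ((x + y) ⬝ᵥ x) ∧ (x + y) ⬝ᵥ (x + y) ≠ 0 := by
      simp only [sub_dotProduct, dotProduct_sub, add_dotProduct, dotProduct_add, hxy,
        dotProduct_comm y x] at h ⊢
      refine ⟨by ring, fun h0 => hy ?_⟩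
      linear_combination (h + h0) / 4
    obtain ⟨H₁, hH₁, hH₁z⟩ := exists_reflection h'.2
    obtain ⟨H₂, hH₂, hH₂z⟩ := exists_reflection hy
    refine ⟨H₂ * H₁, ?_, ?_, fun z hzx hzy => ?_⟩
    · rw [transpose_mul, Matrix.mul_assoc, ← Matrix.mul_assoc H₂ᵀ, hH₂, Matrix.one_mul, hH₁]
    · rw [← mulVec_mulVec, hH₁z, ← h'.1, div_self h'.2, one_smul, sub_add_cancel_left, hH₂z,
        dotProduct_neg, mul_neg, neg_div, mul_div_assoc, div_self hy]
      simp [two_smul]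
    · rw [dotProduct_comm] at hzx hzy
      rw [← mulVec_mulVec, hH₁z, add_dotProduct, hzx, hzy]
      simp [hH₂z, hzy]
  · obtain ⟨H, hH, hHz⟩ := exists_reflection h
    refine ⟨H, hH, ?_, fun z hzx hzy => ?_⟩
    · have h' : (x - y) ⬝ᵥ (x - y) = 2 * ((x - y) ⬝ᵥ x) := by
        simp only [sub_dotProduct, dotProduct_sub, hxy, dotProduct_comm y x]
        ring
      rw [hHz, ← h', div_self h, one_smul, sub_sub_cancel]
    · rw [dotProduct_comm] at hzx hzy
      rw [hHz, sub_dotProduct, hzx, hzy]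
      simp

theorem exists_orthogonal_mulVec_eq_single {ι : Type*} [Fintype ι] [DecidableEq ι] {w : ι → ℂ}
    {d : ℂ} (hd : d ^ 2 = w ⬝ᵥ w) (hw : d = 0 → w = 0) (i : ι) :
    ∃ R : Matrix ι ι ℂ, Rᵀ * R = 1 ∧ R *ᵥ w = Pi.single i d ∧
      ∀ z, z ⬝ᵥ w = 0 → z i = 0 → R *ᵥ z = z := by
  by_cases h : d = 0
  · refine ⟨1, by simp, by simp [h, hw h], fun z _ _ => one_mulVec z⟩
  · have hs : Pi.single i d ⬝ᵥ Pi.single i d = w ⬝ᵥ w := by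
      rw [← hd, single_dotProduct, Pi.single_eq_same, sq]
    obtain ⟨R, hR, hRw, hRz⟩ := exists_orthogonal_mulVec_eq hs.symm
      (by rw [hs, ← hd]; exact pow_ne_zero 2 h)
    exact ⟨R, hR, hRw, fun z hz hzi => hRz z hz (by rw [dotProduct_single, hzi, zero_mul])⟩

/-- Two orthogonal vectors, each zero or non-isotropic, are moved simultaneously to multiples of
two prescribed coordinate vectors. -/
theorem exists_orthogonal_mulVec_eq_single_pair {ι : Type*} [Fintype ι] [DecidableEq ι]
    {w : Fin 2 → ι → ℂ} {d : Fin 2 → ℂ} (hd : ∀ k, d k ^ 2 = w k ⬝ᵥ w k)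
    (hw : ∀ k, d k = 0 → w k = 0) (horth : w 0 ⬝ᵥ w 1 = 0) {s : Fin 2 → ι} (hs : s 0 ≠ s 1) :
    ∃ R : Matrix ι ι ℂ, Rᵀ * R = 1 ∧ ∀ k, R *ᵥ w k = Pi.single (s k) (d k) := by
  obtain ⟨R₀, hR₀, hw₀, -⟩ := exists_orthogonal_mulVec_eq_single (hd 0) (hw 0) (s 0)
  have hdot : ∀ x y, (R₀ *ᵥ x) ⬝ᵥ (R₀ *ᵥ y) = x ⬝ᵥ y := fun x y => by
    rw [dotProduct_mulVec, ← mulVec_transpose, mulVec_mulVec, hR₀, one_mulVec]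
  obtain ⟨R₁, hR₁, hw₁, hz⟩ := exists_orthogonal_mulVec_eq_single (w := R₀ *ᵥ w 1)
    ((hd 1).trans (hdot _ _).symm) (fun h => by rw [hw 1 h, mulVec_zero]) (s 1)
  refine ⟨R₁ * R₀, ?_, ?_⟩
  · rw [transpose_mul, Matrix.mul_assoc, ← Matrix.mul_assoc R₁ᵀ, hR₁, Matrix.one_mul, hR₀]
  · intro k
    rw [← mulVec_mulVec]
    fin_cases k
    · change R₁ *ᵥ (R₀ *ᵥ w 0) = _
      rw [hz _ (by rw [hdot, horth]) (by rw [hw₀]; simp [hs.symm]), hw₀]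
      rfl
    · exact hw₁

/-! ### Orthogonal diagonalisation of a semisimple symmetric `2 × 2` matrix -/

theorem exists_orthogonal_diagonal {G : Matrix (Fin 2) (Fin 2) ℂ} (hG : Gᵀ = G)
    (hss : ∀ (μ : ℂ) (c : Fin 2 → ℂ),
      (G - μ • (1 : Matrix (Fin 2) (Fin 2) ℂ)) *ᵥ
        ((G - μ • (1 : Matrix (Fin 2) (Fin 2) ℂ)) *ᵥ c) = 0 →
      (G - μ • (1 : Matrix (Fin 2) (Fin 2) ℂ)) *ᵥ c = 0) :
    ∃ (C : Matrix (Fin 2) (Fin 2) ℂ) (l : Fin 2 → ℂ), Cᵀ * C = 1 ∧ C * G * Cᵀ = diagonal l := by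
  have h10 : G 1 0 = G 0 1 := congrFun (congrFun hG 0) 1
  obtain ⟨μ, hμ⟩ := Module.End.exists_eigenvalue (toLin' G)
  obtain ⟨c, hc, hc0⟩ := hμ.exists_hasEigenvector
  have hGc : G *ᵥ c = μ • c := Module.End.mem_eigenspace_iff.1 hc
  have e0 : G 0 0 * c 0 + G 0 1 * c 1 = μ * c 0 := by
    simpa [mulVec, dotProduct, Fin.sum_univ_two] using congrFun hGc 0
  have e1 : G 0 1 * c 0 + G 1 1 * c 1 = μ * c 1 := by
    simpa [mulVec, dotProduct, Fin.sum_univ_two, h10] using congrFun hGc 1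
  by_cases hiso : c 0 ^ 2 + c 1 ^ 2 = 0
  · -- An isotropic eigenvector of a symmetric matrix forces `(G - μ)² = 0`, hence `G = μ`.
    have hx : c 0 ≠ 0 := by
      intro hx
      have hy : c 1 = 0 := by simpa [hx] using hiso
      exact hc0 (funext fun k => by fin_cases k <;> assumption)
    have hy : c 1 ≠ 0 := by
      intro hy
      exact hx (by simpa [hy] using hiso)
    have t1 : G 0 0 - μ + (G 1 1 - μ) = 0 := by
      apply mul_left_cancel₀ (mul_ne_zero hx hy)
      linear_combination c 1 * e0 + c 0 * e1 - G 0 1 * hiso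
    have t2 : (G 0 0 - μ) ^ 2 + G 0 1 ^ 2 = 0 := by
      apply mul_left_cancel₀ (pow_ne_zero 2 hx)
      linear_combination ((G 0 0 - μ) * c 0 - G 0 1 * c 1) * e0 + G 0 1 ^ 2 * hiso
    have hN : ∀ c' : Fin 2 → ℂ, (G - μ • (1 : Matrix (Fin 2) (Fin 2) ℂ)) *ᵥ c' = 0 := by
      intro c'
      apply hss
      ext k
      fin_cases k
      · simp [mulVec, dotProduct, Fin.sum_univ_two, h10]
        linear_combination c' 0 * t2 + G 0 1 * c' 1 * t1
      · simp [mulVec, dotProduct, Fin.sum_univ_two, h10]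
        linear_combination c' 1 * t2 + (G 0 1 * c' 0 + c' 1 * (G 1 1 - G 0 0)) * t1
    refine ⟨1, fun _ => μ, by simp, ?_⟩
    have hG' : G - μ • (1 : Matrix (Fin 2) (Fin 2) ℂ) = 0 :=
      Matrix.ext_of_mulVec_single fun i => by rw [hN, zero_mulVec]
    rw [Matrix.one_mul, transpose_one, Matrix.mul_one, sub_eq_zero.1 hG', smul_one_eq_diagonal]
  · -- A non-isotropic eigenvector is normalised and completed by its rotation.
    obtain ⟨r, hr⟩ := IsAlgClosed.exists_pow_nat_eq (c 0 ^ 2 + c 1 ^ 2) (n := 2) (by norm_num)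
    have hr0 : r ≠ 0 := by
      rintro rfl
      exact hiso (by rw [← hr]; ring)
    obtain ⟨x, hx⟩ : ∃ x, x = c 0 / r := ⟨_, rfl⟩
    obtain ⟨y, hy⟩ : ∃ y, y = c 1 / r := ⟨_, rfl⟩
    have hxy : x ^ 2 + y ^ 2 = 1 := by
      rw [hx, hy, div_pow, div_pow, ← add_div, ← hr, div_self (pow_ne_zero 2 hr0)]
    have f0 : G 0 0 * x + G 0 1 * y = μ * x := by
      rw [hx, hy]; field_simp; linear_combination e0
    have f1 : G 0 1 * x + G 1 1 * y = μ * y := by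
      rw [hx, hy]; field_simp; linear_combination e1
    refine ⟨!![x, y; -y, x], ![μ, -y * (G 0 0 * -y + G 0 1 * x) + x * (G 0 1 * -y + G 1 1 * x)],
      ?_, ?_⟩
    · ext i j
      fin_cases i <;> fin_cases j <;> simp [Matrix.mul_apply, Fin.sum_univ_two]
      · linear_combination hxy
      · ring
      · ring
      · linear_combination hxy
    · ext i j
      fin_cases i <;> fin_cases j <;>
        simp [Matrix.mul_apply, vecMul, dotProduct, Fin.sum_univ_two, h10]
      · linear_combination x * f0 + y * f1 + μ * hxy
      · linear_combination -y * f0 + x * f1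
      · linear_combination -y * f0 + x * f1
      · ring

/-! ### The normal form of a semisimple element of `𝔭` -/

/-- The element of `𝔭` with upper right block `A`. -/
def offDiag {p q : ℕ} (A : Matrix (Fin p) (Fin q) ℂ) : soC p q :=
  ⟨fromBlocks 0 A (-Aᵀ) 0, by
    rw [mem_so, fromBlocks_transpose, fromBlocks_neg]
    simp⟩

theorem eq_offDiag {p q : ℕ} {X : soC p q} (hX : X ∈ pPart (soInv p q)) :
    X = offDiag (X.1.toBlocks₁₂) := by
  obtain ⟨h1, h2⟩ := mem_pPart_soInv.1 hX
  apply Subtype.ext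
  ext i j
  rcases i with i | i <;> rcases j with j | j
  · exact h1 i j
  · rfl
  · exact soC_apply_swap X _ _
  · exact h2 i j

/-- The first two elements of `Fin (n + 2)`. -/
def lead (n : ℕ) (k : Fin 2) : Fin (n + 2) := Fin.castLE (by omega) k

theorem lead_injective (n : ℕ) : Function.Injective (lead n) := Fin.castLE_injective (by omega)

/-- The matrix `(diag(d₀, d₁) ; 0)` with `n + 2` rows. -/
def normalBlock (n : ℕ) (d : Fin 2 → ℂ) : Matrix (Fin (n + 2)) (Fin 2) ℂ :=
  of fun i k => if i = lead n k then d k else 0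

/-- For a semisimple `F`, the kernels of `F` and `F²` agree. -/
theorem apply_eq_zero_of_isSemisimple {K V : Type*} [Field K] [AddCommGroup V] [Module K V]
    [FiniteDimensional K V] {F : Module.End K V} (hF : F.IsSemisimple) {v : V}
    (h : F (F v) = 0) : F v = 0 := by
  have h2 := hF.isFinitelySemisimple.genEigenspace_eq_eigenspace (0 : K) (k := (2 : ℕ))
    (by norm_num)
  have hv : v ∈ F.genEigenspace 0 (2 : ℕ) := by
    rw [Module.End.mem_genEigenspace_nat]
    simpa [pow_two] using h
  rw [h2] at hv
  simpa using Module.End.mem_eigenspace_iff.1 hv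

theorem offDiag_mulVec_inr {p q : ℕ} (A : Matrix (Fin p) (Fin q) ℂ) (c : Fin q → ℂ) :
    (offDiag A).1 *ᵥ Sum.elim (0 : Fin p → ℂ) c = Sum.elim (A *ᵥ c) (0 : Fin q → ℂ) := by
  change fromBlocks 0 A (-Aᵀ) 0 *ᵥ _ = _
  rw [fromBlocks_mulVec]
  simp

theorem offDiag_mulVec_inl {p q : ℕ} (A : Matrix (Fin p) (Fin q) ℂ) (c : Fin p → ℂ) :
    (offDiag A).1 *ᵥ Sum.elim c (0 : Fin q → ℂ) = Sum.elim (0 : Fin p → ℂ) (-(Aᵀ *ᵥ c)) := by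
  change fromBlocks 0 A (-Aᵀ) 0 *ᵥ _ = _
  rw [fromBlocks_mulVec]
  simp [neg_mulVec]

/-- If `X ∈ 𝔭` with upper right block `A` is semisimple, then `AᵀA` is semisimple, as `-AᵀA` is
the restriction of `X²`; moreover `AᵀA` has the same kernel as `A`. -/
theorem gram_of_isSemisimple {p q : ℕ} {A : Matrix (Fin p) (Fin q) ℂ}
    (hA : Module.End.IsSemisimple (toLin' (offDiag A).1)) :
    (∀ (μ : ℂ) (c : Fin q → ℂ),
      (Aᵀ * A - μ • (1 : Matrix (Fin q) (Fin q) ℂ)) *ᵥ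
        ((Aᵀ * A - μ • (1 : Matrix (Fin q) (Fin q) ℂ)) *ᵥ c) = 0 →
      (Aᵀ * A - μ • (1 : Matrix (Fin q) (Fin q) ℂ)) *ᵥ c = 0) ∧
    ∀ c, (Aᵀ * A) *ᵥ c = 0 → A *ᵥ c = 0 := by
  constructor
  · intro μ c h
    obtain ⟨F, hF'⟩ : ∃ F : Module.End ℂ (Fin p ⊕ Fin q → ℂ),
        F = toLin' (offDiag A).1 ^ 2 - algebraMap ℂ _ (-μ) := ⟨_, rfl⟩
    have hF : F.IsSemisimple := by
      rw [hF']
      exact Module.End.isSemisimple_sub_algebraMap_iff.2 (hA.pow 2)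
    have hFv : ∀ c : Fin q → ℂ, F (Sum.elim (0 : Fin p → ℂ) c) =
        Sum.elim (0 : Fin p → ℂ) (-((Aᵀ * A - μ • (1 : Matrix (Fin q) (Fin q) ℂ)) *ᵥ c)) := by
      intro c
      rw [hF', LinearMap.sub_apply, pow_two, Module.End.mul_apply, toLin'_apply, toLin'_apply,
        offDiag_mulVec_inr, offDiag_mulVec_inl, Module.algebraMap_end_apply, sub_mulVec,
        mulVec_mulVec, smul_mulVec, one_mulVec]
      ext k
      rcases k with k | k <;> simp
      ring
    have := apply_eq_zero_of_isSemisimple hF (v := Sum.elim (0 : Fin p → ℂ) c) (by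
      rw [hFv, hFv, mulVec_neg, h]
      ext k
      rcases k with k | k <;> simp)
    rw [hFv] at this
    ext k
    simpa using congrFun this (Sum.inr k)
  · intro c h
    have := apply_eq_zero_of_isSemisimple hA (v := Sum.elim (0 : Fin p → ℂ) c) (by
      rw [toLin'_apply, toLin'_apply, offDiag_mulVec_inr, offDiag_mulVec_inl, mulVec_mulVec, h]
      ext k
      rcases k with k | k <;> simp)
    rw [toLin'_apply, offDiag_mulVec_inr] at this
    ext k
    simpa using congrFun this (Sum.inl k)

/-- A semisimple element of `𝔭` is conjugate under `O_p × O_2` to `d₀ e₁ ∧ f₁ + d₁ e₂ ∧ f₂`, where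
the signs can be chosen such that `d₀² = d₁²` only if `d₀ = d₁`, and the order such that
`d₀ = 0` only if `d₁ = 0`. -/
theorem exists_normal_form {n : ℕ} {X : soC (n + 2) 2} (hX : X ∈ pPart (soInv (n + 2) 2))
    (hss : Module.End.IsSemisimple (toLin' X.1)) :
    ∃ (d : Fin 2 → ℂ) (g : Matrix (Fin (n + 2) ⊕ Fin 2) (Fin (n + 2) ⊕ Fin 2) ℂ)
      (hg : gᵀ * g = 1), J (n + 2) 2 * g = g * J (n + 2) 2 ∧
      soEmb g hg X = offDiag (normalBlock n d) ∧ (d 0 ^ 2 = d 1 ^ 2 → d 0 = d 1) ∧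
      (d 0 = 0 → d 1 = 0) := by
  obtain ⟨A, hA⟩ : ∃ A, A = X.1.toBlocks₁₂ := ⟨_, rfl⟩
  have hXA : X = offDiag A := by rw [hA]; exact eq_offDiag hX
  subst hXA
  obtain ⟨h1, h2⟩ := gram_of_isSemisimple hss
  obtain ⟨C, l, hC, hCl, hl⟩ : ∃ (C : Matrix (Fin 2) (Fin 2) ℂ) (l : Fin 2 → ℂ),
      Cᵀ * C = 1 ∧ C * (Aᵀ * A) * Cᵀ = diagonal l ∧ (l 0 = 0 → l 1 = 0) := by
    obtain ⟨C, l, hC, hCl⟩ := exists_orthogonal_diagonal (G := Aᵀ * A)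
      (by rw [transpose_mul, transpose_transpose]) h1
    by_cases hl : l 0 = 0
    · -- Interchanging the two eigenvectors puts the zero eigenvalue last.
      refine ⟨!![0, 1; 1, 0] * C, ![l 1, l 0], ?_, ?_, by simp [hl]⟩
      · rw [transpose_mul, Matrix.mul_assoc, ← Matrix.mul_assoc _ _ C]
        have : (!![0, 1; 1, 0] : Matrix (Fin 2) (Fin 2) ℂ)ᵀ * !![0, 1; 1, 0] = 1 := by
          ext i j
          fin_cases i <;> fin_cases j <;> simp [Matrix.mul_apply, Fin.sum_univ_two]
        rw [this, Matrix.one_mul, hC]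
      · rw [transpose_mul]
        calc _ = !![0, 1; 1, 0] * (C * (Aᵀ * A) * Cᵀ) * (!![0, 1; 1, 0])ᵀ := by
              simp only [Matrix.mul_assoc]
          _ = _ := by
              rw [hCl]
              ext i j
              fin_cases i <;> fin_cases j <;>
                simp [Matrix.mul_apply, vecMul, dotProduct, Fin.sum_univ_two]
    · exact ⟨C, l, hC, hCl, fun h => absurd h hl⟩
  -- Taking the principal square root throughout makes `d k` a function of `l k`, so that
  -- `d 0 ^ 2 = d 1 ^ 2` implies `d 0 = d 1`.
  let d : Fin 2 → ℂ := fun k => l k ^ (((2 : ℕ) : ℂ)⁻¹)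
  have hd : ∀ k, d k ^ 2 = l k := fun k => Complex.cpow_nat_inv_pow (l k) two_ne_zero
  have hdl : ∀ k, d k = 0 → l k = 0 := fun k h => by rw [← hd, h]; simp
  have hw : ∀ i j, (A *ᵥ C i) ⬝ᵥ (A *ᵥ C j) = diagonal l i j := by
    intro i j
    rw [← hCl, dotProduct_mulVec, ← vecMul_transpose, vecMul_vecMul]
    rfl
  obtain ⟨R, hR, hRw⟩ := exists_orthogonal_mulVec_eq_single_pair (w := fun k => A *ᵥ C k) (d := d)
    (fun k => by rw [hd, hw, diagonal_apply_eq])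
    (fun k hk => h2 _ (by
      have : (Aᵀ * A) * Cᵀ = Cᵀ * diagonal l := by
        rw [← hCl, ← Matrix.mul_assoc, ← Matrix.mul_assoc, hC, Matrix.one_mul]
      ext i
      have := congrFun (congrFun this i) k
      rw [mul_diagonal, hdl k hk, mul_zero] at this
      exact this))
    (by rw [hw]; simp) (s := lead n) ((lead_injective n).ne (by simp))
  have hg : (fromBlocks R 0 0 C)ᵀ * fromBlocks R 0 0 C = 1 := by
    rw [fromBlocks_transpose, fromBlocks_multiply]
    simp [hR, hC]
  refine ⟨d, fromBlocks R 0 0 C, hg, ?_, ?_, ?_, ?_⟩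
  · have hJ : J (n + 2) 2 = fromBlocks 1 0 0 (-1) := by
      ext i j
      rcases i with i | i <;> rcases j with j | j <;>
        simp [indefiniteDiagonal, diagonal_apply, one_apply, apply_ite]
    rw [hJ, fromBlocks_multiply, fromBlocks_multiply]
    simp
  · have hRA : R * A * Cᵀ = normalBlock n d := by
      ext i k
      have := congrFun (hRw k) i
      rw [mulVec_mulVec] at this
      change (R * A * Cᵀ) i k = _ at this
      rw [this, normalBlock, of_apply, Pi.single_apply]
    apply Subtype.ext
    change fromBlocks R 0 0 C * fromBlocks 0 A (-Aᵀ) 0 * (fromBlocks R 0 0 C)ᵀ =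
      fromBlocks 0 (normalBlock n d) (-(normalBlock n d)ᵀ) 0
    rw [← hRA, fromBlocks_transpose, fromBlocks_multiply, fromBlocks_multiply]
    simp [Matrix.mul_assoc]
  · intro h
    rw [hd, hd] at h
    change l 0 ^ _ = l 1 ^ _
    rw [h]
  · intro h
    exact pow_eq_zero_iff two_ne_zero |>.1 ((hd 1).trans (hl (hdl 0 h)))

/-! ### The centralizer of an element in normal form -/

section Centralizer

variable {n : ℕ} {d : Fin 2 → ℂ}

theorem offDiag_mul_inl (M : Matrix (Fin (n + 2) ⊕ Fin 2) (Fin (n + 2) ⊕ Fin 2) ℂ) (k : Fin 2)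
    (j : Fin (n + 2) ⊕ Fin 2) :
    ((offDiag (normalBlock n d)).1 * M) (Sum.inl (lead n k)) j = d k * M (Sum.inr k) j := by
  simp [offDiag, mul_apply, normalBlock, (lead_injective n).eq_iff]

theorem offDiag_mul_inr (M : Matrix (Fin (n + 2) ⊕ Fin 2) (Fin (n + 2) ⊕ Fin 2) ℂ) (k : Fin 2)
    (j : Fin (n + 2) ⊕ Fin 2) :
    ((offDiag (normalBlock n d)).1 * M) (Sum.inr k) j = -(d k * M (Sum.inl (lead n k)) j) := by
  simp [offDiag, mul_apply, normalBlock]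

theorem mul_offDiag_inr (M : Matrix (Fin (n + 2) ⊕ Fin 2) (Fin (n + 2) ⊕ Fin 2) ℂ) (l : Fin 2)
    (i : Fin (n + 2) ⊕ Fin 2) :
    (M * (offDiag (normalBlock n d)).1) i (Sum.inr l) = d l * M i (Sum.inl (lead n l)) := by
  simp [offDiag, mul_apply, normalBlock, mul_comm]

theorem mul_offDiag_inl (M : Matrix (Fin (n + 2) ⊕ Fin 2) (Fin (n + 2) ⊕ Fin 2) ℂ) (l : Fin 2)
    (i : Fin (n + 2) ⊕ Fin 2) :
    (M * (offDiag (normalBlock n d)).1) i (Sum.inl (lead n l)) = -(d l * M i (Sum.inr l)) := by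
  simp [offDiag, mul_apply, normalBlock, (lead_injective n).eq_iff, mul_comm]

theorem mul_offDiag_of_notMem (M : Matrix (Fin (n + 2) ⊕ Fin 2) (Fin (n + 2) ⊕ Fin 2) ℂ)
    {j : Fin (n + 2)} (hj : ∀ l, j ≠ lead n l) (i : Fin (n + 2) ⊕ Fin 2) :
    (M * (offDiag (normalBlock n d)).1) i (Sum.inl j) = 0 := by
  simp [offDiag, mul_apply, normalBlock, hj]

theorem mul_comm_of_mem_cent {p q : ℕ} {X M : soC p q} (hM : M ∈ cent X) : X.1 * M.1 = M.1 * X.1 :=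
  sub_eq_zero.1 (congrArg Subtype.val (show ⁅X, M⁆ = 0 from hM))

/-- The vectors `e_k` and `f_k` span an `M`-invariant plane. As `M` is skew-symmetric, this is
expressed through rows instead of columns. -/
def IsIsolated (M : soC (n + 2) 2) (k : Fin 2) : Prop :=
  (∀ j ≠ Sum.inr k, M.1 (Sum.inl (lead n k)) j = 0) ∧
    ∀ j ≠ Sum.inl (lead n k), M.1 (Sum.inr k) j = 0

/-- The centralizer preserves the plane spanned by `e_k` and `f_k`, as this is the sum of the
eigenspaces of `X` for the eigenvalues `± i d_k`. -/
theorem isIsolated_of_mem_cent {k : Fin 2} (hk : d k ≠ 0) (hkl : ∀ l ≠ k, d k ^ 2 ≠ d l ^ 2)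
    {M : soC (n + 2) 2} (hM : M ∈ cent (offDiag (normalBlock n d))) : IsIsolated M k := by
  have hXM := mul_comm_of_mem_cent hM
  have h1 : ∀ j, d k * M.1 (Sum.inr k) j =
      (M.1 * (offDiag (normalBlock n d)).1) (Sum.inl (lead n k)) j := fun j => by
    rw [← hXM, offDiag_mul_inl]
  have h2 : ∀ j, d k * M.1 (Sum.inl (lead n k)) j =
      -(M.1 * (offDiag (normalBlock n d)).1) (Sum.inr k) j := fun j => by
    rw [← hXM, offDiag_mul_inr, neg_neg]
  have h0 : ∀ l ≠ k, ∀ x y : ℂ, d k * x = d l * y → d k * y = d l * x → x = 0 := by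
    intro l hl x y hx hy
    have : (d k ^ 2 - d l ^ 2) * x = 0 := by linear_combination d k * hx + d l * hy
    exact (mul_eq_zero.1 this).resolve_left (sub_ne_zero.2 (hkl l hl))
  have a1 : ∀ l, d k * M.1 (Sum.inr k) (Sum.inl (lead n l)) =
      -(d l * M.1 (Sum.inl (lead n k)) (Sum.inr l)) := fun l => by rw [h1, mul_offDiag_inl]
  have a2 : ∀ l, d k * M.1 (Sum.inr k) (Sum.inr l) =
      d l * M.1 (Sum.inl (lead n k)) (Sum.inl (lead n l)) := fun l => by rw [h1, mul_offDiag_inr]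
  have a3 : ∀ l, d k * M.1 (Sum.inl (lead n k)) (Sum.inl (lead n l)) =
      d l * M.1 (Sum.inr k) (Sum.inr l) := fun l => by rw [h2, mul_offDiag_inl, neg_neg]
  have a4 : ∀ l, d k * M.1 (Sum.inl (lead n k)) (Sum.inr l) =
      -(d l * M.1 (Sum.inr k) (Sum.inl (lead n l))) := fun l => by rw [h2, mul_offDiag_inr]
  constructor
  · rintro (j | l) hj
    · by_cases hjl : ∃ l, j = lead n l
      · obtain ⟨l, rfl⟩ := hjl
        by_cases hl : l = k
        · rw [hl, soC_apply_self]
        · exact h0 l hl _ _ (a3 l) (a2 l)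
      · push Not at hjl
        have := h2 (Sum.inl j)
        rw [mul_offDiag_of_notMem _ hjl, neg_zero] at this
        exact (mul_eq_zero.1 this).resolve_left hk
    · have hl : l ≠ k := fun h => hj (by rw [h])
      exact h0 l hl _ (-M.1 (Sum.inr k) (Sum.inl (lead n l))) (by rw [a4, mul_neg])
        (by rw [mul_neg, a1, neg_neg])
  · rintro (j | l) hj
    · by_cases hjl : ∃ l, j = lead n l
      · obtain ⟨l, rfl⟩ := hjl
        have hl : l ≠ k := fun h => hj (by rw [h])
        exact h0 l hl _ (-M.1 (Sum.inl (lead n k)) (Sum.inr l)) (by rw [a1, mul_neg])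
          (by rw [mul_neg, a4, neg_neg])
      · push Not at hjl
        have := h1 (Sum.inl j)
        rw [mul_offDiag_of_notMem _ hjl] at this
        exact (mul_eq_zero.1 this).resolve_left hk
    · by_cases hl : l = k
      · rw [hl, soC_apply_self]
      · exact h0 l hl _ _ (a2 l) (a3 l)

/-- If the centralizer preserves the plane spanned by `e_k` and `f_k`, then its derived algebra
acts on that plane through `[so_2, so_2] = 0`. -/
theorem apply_eq_zero_of_isIsolated {X : soC (n + 2) 2} {k : Fin 2}
    (h : ∀ M ∈ cent X, IsIsolated M k) {Y : soC (n + 2) 2} (hY : Y ∈ lPart X) :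
    Y.1 (Sum.inl (lead n k)) (Sum.inr k) = 0 := by
  have key : ∀ M N : soC (n + 2) 2, IsIsolated M k →
      (M.1 * N.1) (Sum.inl (lead n k)) (Sum.inr k) = 0 := by
    intro M N hM
    rw [mul_apply]
    refine Finset.sum_eq_zero fun j _ => ?_
    by_cases hj : j = Sum.inr k
    · rw [hj, soC_apply_self, mul_zero]
    · rw [hM.1 j hj, zero_mul]
  refine Submodule.span_induction (p := fun Y _ => Y.1 (Sum.inl (lead n k)) (Sum.inr k) = 0)
    ?_ rfl ?_ ?_ hY
  · rintro _ ⟨M, hM, N, hN, rfl⟩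
    change (M.1 * N.1) _ _ - (N.1 * M.1) _ _ = 0
    rw [key M N (h M hM), key N M (h N hN), sub_zero]
  · intro Y Z _ _ hY hZ
    change Y.1 _ _ + Z.1 _ _ = 0
    rw [hY, hZ, add_zero]
  · intro c Y _ hY
    change c * Y.1 _ _ = 0
    rw [hY, mul_zero]

/-- If the planes spanned by `e_k` and `f_k` are invariant under the centralizer for both `k`, then
an element of `𝔭^X` has no entries outside them, and one of `𝔩₋` none at all. -/
theorem lMinus_eq_bot_of_isIsolated {X : soC (n + 2) 2}
    (h : ∀ k, ∀ M ∈ cent X, IsIsolated M k) : lMinus (soInv (n + 2) 2) X = ⊥ := by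
  refine eq_bot_iff.2 fun Y hY => ?_
  have hYp := mem_pPart_soInv.1 hY.2.1
  have h0 : ∀ i k, Y.1 (Sum.inl i) (Sum.inr k) = 0 := by
    intro i k
    by_cases hi : i = lead n k
    · rw [hi]
      exact apply_eq_zero_of_isIsolated (h k) hY.1
    · rw [soC_apply_swap Y (Sum.inr k), (h k Y hY.2.2).2 _ (by simpa using hi), neg_zero]
  refine Subtype.ext (Matrix.ext fun i j => ?_)
  rcases i with i | i <;> rcases j with j | j
  · exact hYp.1 i j
  · exact h0 i j
  · rw [soC_apply_swap Y (Sum.inl j), h0]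
    exact neg_zero
  · exact hYp.2 i j

end Centralizer

/-! ### Coordinate embeddings -/

/-- The matrix of the coordinate embedding along `ι`. -/
def coordMatrix {α β : Type*} [DecidableEq β] (ι : α → β) : Matrix β α ℂ :=
  of fun i j => if i = ι j then 1 else 0

section Coord

variable {α β : Type*} [Fintype β] [DecidableEq α] [DecidableEq β] {ι : α → β}

theorem coordMatrix_transpose_mul (hι : Function.Injective ι) :
    (coordMatrix ι)ᵀ * coordMatrix ι = 1 := by
  ext i j
  simp [coordMatrix, mul_apply, one_apply, hι.eq_iff, eq_comm]

variable [Fintype α]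

theorem soEmb_coordMatrix_apply (hι : Function.Injective ι) (Y : so α ℂ) (i j : α) :
    (soEmb _ (coordMatrix_transpose_mul hι) Y).1 (ι i) (ι j) = Y.1 i j := by
  rw [soEmb_val]
  simp [coordMatrix, mul_apply, hι.eq_iff]

theorem soEmb_coordMatrix_apply_left (hι : Function.Injective ι) (Y : so α ℂ) {i : β}
    (hi : ∀ a, i ≠ ι a) (j : β) : (soEmb _ (coordMatrix_transpose_mul hι) Y).1 i j = 0 := by
  rw [soEmb_val]
  simp [coordMatrix, mul_apply, hi]

theorem soEmb_coordMatrix_apply_right (hι : Function.Injective ι) (Y : so α ℂ) {j : β}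
    (hj : ∀ a, j ≠ ι a) (i : β) : (soEmb _ (coordMatrix_transpose_mul hι) Y).1 i j = 0 := by
  rw [soEmb_val]
  simp [coordMatrix, mul_apply, hj]

/-- A matrix supported on the range of `ι` is the image of its restriction along `ι`. -/
theorem soEmb_coordMatrix_eq (hι : Function.Injective ι) {Y : so α ℂ} {Z : so β ℂ}
    (h : ∀ i j, Z.1 (ι i) (ι j) = Y.1 i j) (h0 : ∀ i, (∀ a, i ≠ ι a) → ∀ j, Z.1 i j = 0) :
    soEmb _ (coordMatrix_transpose_mul hι) Y = Z := by
  refine Subtype.ext (Matrix.ext fun i j => ?_)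
  by_cases hi : ∃ a, i = ι a
  · obtain ⟨a, rfl⟩ := hi
    by_cases hj : ∃ b, j = ι b
    · obtain ⟨b, rfl⟩ := hj
      rw [soEmb_coordMatrix_apply hι, h]
    · push Not at hj
      have hZ : Z.1 (ι a) j = -Z.1 j (ι a) := congrFun (congrFun ((mem_so _ _ _).1 Z.2) j) (ι a)
      rw [soEmb_coordMatrix_apply_right hι Y hj, hZ, h0 j hj, neg_zero]
  · push Not at hi
    rw [soEmb_coordMatrix_apply_left hι Y hi, h0 i hi]

end Coord

theorem J_mul_coordMatrix {m r p q : ℕ} (a : Fin m → Fin p) (b : Fin r → Fin q) :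
    J p q * coordMatrix (Sum.map a b) = coordMatrix (Sum.map a b) * J m r := by
  ext i j
  rw [J, J, indefiniteDiagonal, indefiniteDiagonal, diagonal_mul, mul_diagonal]
  rcases i with i | i <;> rcases j with j | j <;> simp [coordMatrix, apply_ite]

/-! ### The singular case `d₁ = 0` -/

/-- The centralizer of `d₀ e₁ ∧ f₁` is `so_2 × so_p`, and `𝔩 = so_p` is embedded along the
coordinates other than `e₁` and `f₁`. -/
theorem hasModel_of_eq_zero {n : ℕ} (hn : 1 ≤ n) {d : Fin 2 → ℂ} (h0 : d 0 ≠ 0) (h1 : d 1 = 0) :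
    HasModel (offDiag (normalBlock n d)) := by
  have hι : Function.Injective
      (Sum.map Fin.succ (fun _ => 1) : Fin (n + 1) ⊕ Fin 1 → Fin (n + 2) ⊕ Fin 2) :=
    Sum.map_injective.2 ⟨Fin.succ_injective _, fun _ _ _ => Subsingleton.elim _ _⟩
  have hiso : ∀ M ∈ cent (offDiag (normalBlock n d)), IsIsolated M 0 := fun M hM =>
    isIsolated_of_mem_cent h0 (fun l hl => by
      obtain rfl : l = 1 := by omega
      simp [h0, h1]) hM
  refine ⟨n + 1, soEmb _ (coordMatrix_transpose_mul hι), soEmb_injective _ _, le_antisymm ?_ ?_⟩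
  · refine map_pPart_le_lMinus _ (soInv_soEmb _ _ (J_mul_coordMatrix _ _)) (fun Y => ?_)
      (pPart_le_bracketSpan_top (by omega))
    have hX : (offDiag (normalBlock n d)).1 * coordMatrix
        (Sum.map Fin.succ (fun _ => 1) : Fin (n + 1) ⊕ Fin 1 → Fin (n + 2) ⊕ Fin 2) = 0 := by
      have hB : ∀ (i : Fin (n + 1)) k, normalBlock n d i.succ k = 0 := by
        intro i k
        fin_cases k
        · simp [normalBlock, lead]
        · simp [normalBlock, h1]
      have hB' : ∀ i, normalBlock n d i 1 = 0 := by simp [normalBlock, h1]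
      ext i j
      rcases i with i | i <;> rcases j with j | j <;>
        simp [offDiag, coordMatrix, mul_apply, hB, hB']
    have hX' : (coordMatrix (Sum.map Fin.succ (fun _ => 1) : Fin (n + 1) ⊕ Fin 1 →
        Fin (n + 2) ⊕ Fin 2))ᵀ * (offDiag (normalBlock n d)).1 = 0 := by
      have := congrArg transpose hX
      rwa [transpose_mul, (mem_so _ _ _).1 (offDiag (normalBlock n d)).2, Matrix.mul_neg,
        transpose_zero, neg_eq_zero] at this
    apply Subtype.ext
    change (offDiag (normalBlock n d)).1 * (soEmb _ _ Y).1 -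
      (soEmb _ _ Y).1 * (offDiag (normalBlock n d)).1 = 0
    rw [soEmb_val, ← Matrix.mul_assoc, ← Matrix.mul_assoc, hX, Matrix.mul_assoc _ _ᵀ, hX']
    simp
  · intro Y hY
    have hYp := mem_pPart_soInv.1 hY.2.1
    refine ⟨⟨Y.1.submatrix (Sum.map Fin.succ (fun _ => 1)) (Sum.map Fin.succ (fun _ => 1)), ?_⟩,
      ?_, ?_⟩
    · rw [mem_so, transpose_submatrix, (mem_so _ _ _).1 Y.2]
      rfl
    · exact mem_pPart_soInv.2 ⟨fun i j => hYp.1 _ _, fun i j => hYp.2 _ _⟩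
    · refine soEmb_coordMatrix_eq hι (fun i j => rfl) ?_
      have hcorner : Y.1 (Sum.inl (lead n 0)) (Sum.inr 0) = 0 :=
        apply_eq_zero_of_isIsolated hiso hY.1
      obtain ⟨hr1, hr2⟩ := hiso Y hY.2.2
      rintro (i | i) hi j
      · obtain rfl : i = lead n 0 := by
          obtain rfl | ⟨a, rfl⟩ := Fin.eq_zero_or_eq_succ i
          · rfl
          · exact absurd rfl (hi (Sum.inl a))
        by_cases hj : j = Sum.inr 0
        · rw [hj, hcorner]
        · exact hr1 j hj
      · obtain rfl : i = 0 := by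
          by_contra hne
          obtain rfl : i = 1 := by omega
          exact hi (Sum.inr 0) rfl
        by_cases hj : j = Sum.inl (lead n 0)
        · rw [hj, soC_apply_swap Y (Sum.inl _), hcorner, neg_zero]
        · exact hr2 j hj

/-! ### The singular case `d₀ = d₁` -/

/-- The blocks `(D, B; -B, D)` with `D` the skew matrix `(0, z; -z, 0)` and `B` the traceless
symmetric matrix `(x, y; y, -x)`. -/
def slTwoMatrix (x y z : ℂ) : Matrix (Fin 2 ⊕ Fin 2) (Fin 2 ⊕ Fin 2) ℂ :=
  fromBlocks !![0, z; -z, 0] !![x, y; y, -x] (-!![x, y; y, -x]) !![0, z; -z, 0]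

theorem slTwoMatrix_transpose (x y z : ℂ) : (slTwoMatrix x y z)ᵀ = -slTwoMatrix x y z := by
  rw [slTwoMatrix, fromBlocks_transpose, fromBlocks_neg]
  congr 1 <;> ext i j <;> fin_cases i <;> fin_cases j <;> simp

theorem slTwoMatrix_add (x y z x' y' z' : ℂ) :
    slTwoMatrix (x + x') (y + y') (z + z') = slTwoMatrix x y z + slTwoMatrix x' y' z' := by
  rw [slTwoMatrix, slTwoMatrix, slTwoMatrix, fromBlocks_add]
  congr 1 <;> ext i j <;> fin_cases i <;> fin_cases j <;> simp <;> ring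

theorem slTwoMatrix_smul (c x y z : ℂ) :
    slTwoMatrix (c * x) (c * y) (c * z) = c • slTwoMatrix x y z := by
  rw [slTwoMatrix, slTwoMatrix, fromBlocks_smul]
  congr 1 <;> ext i j <;> fin_cases i <;> fin_cases j <;> simp

theorem slTwoMatrix_commutator (x y z x' y' z' : ℂ) :
    slTwoMatrix x y z * slTwoMatrix x' y' z' - slTwoMatrix x' y' z' * slTwoMatrix x y z =
      slTwoMatrix (2 * (z * y' - z' * y)) (2 * (z' * x - z * x')) (2 * (x' * y - x * y')) := by
  rw [slTwoMatrix, slTwoMatrix, slTwoMatrix, fromBlocks_multiply, fromBlocks_multiply,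
    sub_eq_add_neg, fromBlocks_neg, fromBlocks_add]
  congr 1 <;> ext i j <;> fin_cases i <;> fin_cases j <;>
    simp <;> ring

theorem soThree_lie_apply (Y Z : soC 2 1) (i j : Fin 2 ⊕ Fin 1) :
    (⁅Y, Z⁆ : soC 2 1).1 i j =
      Y.1 i (Sum.inl 0) * Z.1 (Sum.inl 0) j + Y.1 i (Sum.inl 1) * Z.1 (Sum.inl 1) j +
        Y.1 i (Sum.inr 0) * Z.1 (Sum.inr 0) j -
      (Z.1 i (Sum.inl 0) * Y.1 (Sum.inl 0) j + Z.1 i (Sum.inl 1) * Y.1 (Sum.inl 1) j +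
        Z.1 i (Sum.inr 0) * Y.1 (Sum.inr 0) j) := by
  change (Y.1 * Z.1) i j - (Z.1 * Y.1) i j = _
  simp [mul_apply, Fin.sum_univ_two]

/-- The embedding of `so_3` into `so_4` as the derived algebra `sl_2` of the centralizer `gl_2` of
`e₁ ∧ f₁ + e₂ ∧ f₂`. The factor `1/2` matches the structure constants of the two algebras. -/
noncomputable def soThreeEmb : soC 2 1 →ₗ⁅ℂ⁆ soC 2 2 where
  toFun Y := ⟨slTwoMatrix (2⁻¹ * Y.1 (Sum.inl 0) (Sum.inr 0)) (2⁻¹ * Y.1 (Sum.inl 1) (Sum.inr 0))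
    (2⁻¹ * Y.1 (Sum.inl 0) (Sum.inl 1)), (mem_so _ _ _).2 (slTwoMatrix_transpose _ _ _)⟩
  map_add' Y Z := by
    apply Subtype.ext
    change _ = slTwoMatrix _ _ _ + slTwoMatrix _ _ _
    rw [← slTwoMatrix_add, ← mul_add, ← mul_add, ← mul_add]
    rfl
  map_smul' c Y := by
    apply Subtype.ext
    change _ = c • slTwoMatrix _ _ _
    rw [← slTwoMatrix_smul, mul_left_comm c, mul_left_comm c, mul_left_comm c]
    rfl
  map_lie' := by
    intro Y Z
    apply Subtype.ext
    change slTwoMatrix _ _ _ =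
      slTwoMatrix _ _ _ * slTwoMatrix _ _ _ - slTwoMatrix _ _ _ * slTwoMatrix _ _ _
    rw [slTwoMatrix_commutator]
    simp only [soThree_lie_apply, soC_apply_self Y, soC_apply_self Z,
      soC_apply_swap Y (Sum.inl _) (Sum.inr _),
      soC_apply_swap Z (Sum.inl _) (Sum.inr _), soC_apply_swap Y (Sum.inl 0) (Sum.inl 1),
      soC_apply_swap Z (Sum.inl 0) (Sum.inl 1)]
    congr 1 <;> ring

theorem soThreeEmb_offDiag_val (C : Matrix (Fin 2) (Fin 1) ℂ) :
    (soThreeEmb (offDiag C)).1 = slTwoMatrix (2⁻¹ * C 0 0) (2⁻¹ * C 1 0) (2⁻¹ * 0) := rfl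

theorem soThreeEmb_injective : Function.Injective soThreeEmb := by
  refine (injective_iff_map_eq_zero _).2 fun Y hY => ?_
  have h : ∀ i j, (soThreeEmb Y).1 i j = 0 := fun i j => by rw [hY]; rfl
  have hx : Y.1 (Sum.inl 0) (Sum.inr 0) = 0 := by
    simpa [soThreeEmb, slTwoMatrix] using h (Sum.inl 0) (Sum.inr 0)
  have hy : Y.1 (Sum.inl 1) (Sum.inr 0) = 0 := by
    simpa [soThreeEmb, slTwoMatrix] using h (Sum.inl 0) (Sum.inr 1)
  have hz : Y.1 (Sum.inl 0) (Sum.inl 1) = 0 := by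
    simpa [soThreeEmb, slTwoMatrix] using h (Sum.inl 0) (Sum.inl 1)
  refine Subtype.ext (Matrix.ext fun i j => ?_)
  change _ = (0 : ℂ)
  rcases i with i | i <;> rcases j with j | j <;> fin_cases i <;> fin_cases j <;>
    simp [soC_apply_self, hx, hy, hz, soC_apply_swap Y (Sum.inl _) (Sum.inr _),
      soC_apply_swap Y (Sum.inl 0) (Sum.inl 1)]

theorem soInv_soThreeEmb (Y : soC 2 1) :
    soInv 2 2 (soThreeEmb Y) = soThreeEmb (soInv 2 1 Y) := by
  refine Subtype.ext (Matrix.ext fun i j => ?_)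
  rw [soInv_apply_apply]
  change _ * slTwoMatrix _ _ _ i j * _ = slTwoMatrix _ _ _ i j
  rw [soInv_apply_apply, soInv_apply_apply, soInv_apply_apply]
  rcases i with i | i <;> rcases j with j | j <;> fin_cases i <;> fin_cases j <;>
    simp [slTwoMatrix]

theorem trace_offDiag_mul {p q : ℕ} (A B : Matrix (Fin p) (Fin q) ℂ) :
    ((offDiag A).1 * (offDiag B).1).trace = -2 * ∑ k, ∑ i, A i k * B i k := by
  have h : (offDiag A).1 * (offDiag B).1 = fromBlocks (-(A * Bᵀ)) 0 0 (-(Aᵀ * B)) := by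
    change fromBlocks 0 A (-Aᵀ) 0 * fromBlocks 0 B (-Bᵀ) 0 = _
    rw [fromBlocks_multiply]
    simp
  have h1 : (A * Bᵀ).trace = (Aᵀ * B).trace := by
    rw [← trace_transpose, transpose_mul, transpose_transpose, trace_mul_comm]
  have h2 : (Aᵀ * B).trace = ∑ k, ∑ i, A i k * B i k := rfl
  have h3 : ∀ (P : Matrix (Fin p) (Fin p) ℂ) (Q : Matrix (Fin q) (Fin q) ℂ),
      (fromBlocks P 0 0 Q).trace = P.trace + Q.trace := fun P Q => by simp [trace]
  rw [h, h3, trace_neg, trace_neg, h1, h2]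
  ring

/-- The trace form pairs `X` to zero with `𝔩`, because `tr (X [M, N]) = tr ([X, M] N)`. -/
theorem trace_mul_eq_zero_of_mem_lPart {p q : ℕ} {X Y : soC p q} (hY : Y ∈ lPart X) :
    (X.1 * Y.1).trace = 0 := by
  refine Submodule.span_induction (p := fun Y _ => (X.1 * Y.1).trace = 0) ?_ ?_ ?_ ?_ hY
  · rintro _ ⟨M, hM, N, hN, rfl⟩
    have hXM : X.1 * M.1 = M.1 * X.1 := mul_comm_of_mem_cent hM
    change (X.1 * (M.1 * N.1 - N.1 * M.1)).trace = 0
    rw [Matrix.mul_sub, trace_sub, ← Matrix.mul_assoc, hXM, Matrix.mul_assoc, trace_mul_comm M.1,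
      Matrix.mul_assoc, sub_self]
  · exact (congrArg trace (Matrix.mul_zero _)).trans (trace_zero _ _)
  · intro Y Z _ _ hY hZ
    change (X.1 * (Y.1 + Z.1)).trace = 0
    rw [Matrix.mul_add, trace_add, hY, hZ, add_zero]
  · intro c Y _ hY
    change (X.1 * (c • Y.1)).trace = 0
    rw [Matrix.mul_smul, trace_smul, hY, smul_zero]

theorem offDiag_normalBlock_eq_soEmb {n : ℕ} (d : Fin 2 → ℂ)
    (hι : Function.Injective (Sum.map (lead n) id : Fin 2 ⊕ Fin 2 → Fin (n + 2) ⊕ Fin 2)) :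
    offDiag (normalBlock n d) =
      soEmb _ (coordMatrix_transpose_mul hι) (offDiag (diagonal d)) := by
  have h : ∀ i j, normalBlock n d (lead n i) j = diagonal d i j := by
    intro i j
    by_cases hij : i = j
    · rw [hij, diagonal_apply_eq]
      exact if_pos rfl
    · rw [diagonal_apply_ne _ hij]
      exact if_neg ((lead_injective n).ne hij)
  refine (soEmb_coordMatrix_eq hι ?_ ?_).symm
  · rintro (i | i) (j | j)
    · rfl
    · exact h i j
    · exact congrArg Neg.neg (h j i)
    · rfl
  · rintro (i | i) hi (j | j)
    · rfl
    · have : ∀ k, i ≠ lead n k := fun k hk => hi (Sum.inl k) (by rw [hk]; rfl)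
      exact if_neg (this j)
    · exact absurd rfl (hi (Sum.inr i))
    · rfl

theorem lie_offDiag_soThreeEmb {d : Fin 2 → ℂ} (hd : d 0 = d 1) (Y : soC 2 1) :
    ⁅(offDiag (diagonal d) : soC 2 2), soThreeEmb Y⁆ = 0 := by
  apply Subtype.ext
  change fromBlocks 0 (diagonal d) (-(diagonal d)ᵀ) 0 * slTwoMatrix _ _ _ -
    slTwoMatrix _ _ _ * fromBlocks 0 (diagonal d) (-(diagonal d)ᵀ) 0 = 0
  have hd' : diagonal d = d 0 • (1 : Matrix (Fin 2) (Fin 2) ℂ) := by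
    rw [smul_one_eq_diagonal]
    congr 1
    ext k
    fin_cases k
    · rfl
    · exact hd.symm
  rw [hd', slTwoMatrix, fromBlocks_multiply, fromBlocks_multiply]
  simp

/-- In the case `d₀ = d₁` the elements of `𝔩₋` have upper right block `(B ; 0)` with `B` a
traceless symmetric `2 × 2` matrix. -/
theorem apply_of_mem_lMinus {n : ℕ} {d : Fin 2 → ℂ} (h0 : d 0 ≠ 0) (h1 : d 0 = d 1)
    {Y : soC (n + 2) 2} (hY : Y ∈ lMinus (soInv (n + 2) 2) (offDiag (normalBlock n d))) :
    (∀ k j, (∀ l, j ≠ lead n l) → Y.1 (Sum.inr k) (Sum.inl j) = 0) ∧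
      Y.1 (Sum.inl (lead n 1)) (Sum.inr 0) = Y.1 (Sum.inl (lead n 0)) (Sum.inr 1) ∧
      Y.1 (Sum.inl (lead n 1)) (Sum.inr 1) = -Y.1 (Sum.inl (lead n 0)) (Sum.inr 0) := by
  have hXY := mul_comm_of_mem_cent hY.2.2
  refine ⟨fun k j hj => ?_, ?_, eq_neg_of_add_eq_zero_right ?_⟩
  · have := congrFun (congrFun hXY (Sum.inl (lead n k))) (Sum.inl j)
    rw [offDiag_mul_inl, mul_offDiag_of_notMem _ hj] at this
    refine (mul_eq_zero.1 this).resolve_left ?_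
    obtain rfl | rfl : k = 0 ∨ k = 1 := by omega
    · exact h0
    · exact h1 ▸ h0
  · have := congrFun (congrFun hXY (Sum.inl (lead n 0))) (Sum.inl (lead n 1))
    rw [offDiag_mul_inl, mul_offDiag_inl, ← h1, soC_apply_swap Y (Sum.inl _), mul_neg,
      neg_inj] at this
    exact mul_left_cancel₀ h0 this
  · have := trace_mul_eq_zero_of_mem_lPart hY.1
    rw [eq_offDiag hY.2.1, trace_offDiag_mul] at this
    simpa [normalBlock, Fin.sum_univ_two, ← h1, ← mul_add, h0, toBlocks₁₂] using this

/-- The subspace `𝔩₋` consists of the traceless symmetric matrices in the factor `gl_2` of the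
centralizer. -/
theorem hasModel_of_eq {n : ℕ} {d : Fin 2 → ℂ} (h0 : d 0 ≠ 0) (h1 : d 0 = d 1) :
    HasModel (offDiag (normalBlock n d)) := by
  have hι : Function.Injective (Sum.map (lead n) id : Fin 2 ⊕ Fin 2 → Fin (n + 2) ⊕ Fin 2) :=
    Sum.map_injective.2 ⟨lead_injective n, Function.injective_id⟩
  refine ⟨2, (soEmb _ (coordMatrix_transpose_mul hι)).comp soThreeEmb,
    ?_, le_antisymm ?_ ?_⟩
  · rw [LieHom.coe_comp]
    exact (soEmb_injective _ (coordMatrix_transpose_mul hι)).comp soThreeEmb_injective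
  · refine map_pPart_le_lMinus _ (fun Y => ?_) (fun Y => ?_) (pPart_le_bracketSpan_top le_rfl)
    · rw [LieHom.comp_apply, soInv_soEmb _ _ (J_mul_coordMatrix _ _), soInv_soThreeEmb]
      rfl
    · rw [offDiag_normalBlock_eq_soEmb d hι, LieHom.comp_apply, ← LieHom.map_lie,
        lie_offDiag_soThreeEmb h1, map_zero]
  · intro Y hY
    have hYp := mem_pPart_soInv.1 hY.2.1
    obtain ⟨hzero, hs, ht⟩ := apply_of_mem_lMinus h0 h1 hY
    have hblock : ∀ i j, Y.1 (Sum.inl (lead n i)) (Sum.inr j) =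
        !![Y.1 (Sum.inl (lead n 0)) (Sum.inr 0), Y.1 (Sum.inl (lead n 1)) (Sum.inr 0);
          Y.1 (Sum.inl (lead n 1)) (Sum.inr 0), -Y.1 (Sum.inl (lead n 0)) (Sum.inr 0)] i j := by
      intro i j
      fin_cases i <;> fin_cases j <;> simp [hs, ht]
    have hsym : ∀ x y : ℂ, ∀ i j, (!![x, y; y, -x] : Matrix (Fin 2) (Fin 2) ℂ) i j =
        !![x, y; y, -x] j i := by
      intro x y i j
      fin_cases i <;> fin_cases j <;> rfl
    have hdiag : ∀ i j, (!![0, 0; -0, 0] : Matrix (Fin 2) (Fin 2) ℂ) i j = 0 := by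
      intro i j
      fin_cases i <;> fin_cases j <;> simp
    refine ⟨offDiag (of fun k _ => 2 * Y.1 (Sum.inl (lead n k)) (Sum.inr 0)),
      mem_pPart_soInv.2 ⟨fun _ _ => rfl, fun _ _ => rfl⟩, ?_⟩
    rw [LieHom.coe_toLinearMap, LieHom.comp_apply]
    refine soEmb_coordMatrix_eq hι ?_ ?_
    · intro i j
      rw [soThreeEmb_offDiag_val, of_apply, of_apply, inv_mul_cancel_left₀ two_ne_zero,
        inv_mul_cancel_left₀ two_ne_zero, mul_zero, slTwoMatrix]
      rcases i with i | i <;> rcases j with j | j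
      · rw [fromBlocks_apply₁₁, hdiag]
        exact hYp.1 _ _
      · rw [fromBlocks_apply₁₂]
        exact hblock i j
      · rw [fromBlocks_apply₂₁, Matrix.neg_apply, hsym, ← hblock]
        exact soC_apply_swap Y (Sum.inl (lead n j)) (Sum.inr i)
      · rw [fromBlocks_apply₂₂, hdiag]
        exact hYp.2 _ _
    · rintro (i | i) hi (j | j)
      · exact hYp.1 i j
      · rw [soC_apply_swap Y (Sum.inr j),
          hzero j i fun k hk => hi (Sum.inl k) (by rw [hk]; rfl), neg_zero]
      · exact absurd rfl (hi (Sum.inr i))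
      · exact hYp.2 i j

/-! ### The regular case -/

theorem hasModel_of_sq_ne {n : ℕ} {d : Fin 2 → ℂ} (h0 : d 0 ≠ 0) (h01 : d 0 ^ 2 ≠ d 1 ^ 2)
    (h1 : n = 0 ∨ d 1 ≠ 0) : HasModel (offDiag (normalBlock n d)) := by
  have hiso0 : ∀ M ∈ cent (offDiag (normalBlock n d)), IsIsolated M 0 := fun M hM =>
    isIsolated_of_mem_cent h0 (fun l hl => by
      obtain rfl : l = 1 := by omega
      exact h01) hM
  refine HasModel.of_lMinus_eq_bot (lMinus_eq_bot_of_isIsolated fun k M hM => ?_)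
  obtain rfl | rfl : k = 0 ∨ k = 1 := by omega
  · exact hiso0 M hM
  · rcases h1 with rfl | h1
    · -- In `so_4` the orthogonal complement of the plane of `e₁` and `f₁` is that of `e₂` and `f₂`.
      obtain ⟨hr1, hr2⟩ := hiso0 M hM
      have hlead : ∀ j : Fin 2, j = lead 0 0 ∨ j = lead 0 1 := by decide
      constructor
      · rintro (j | j) hj
        · rcases hlead j with rfl | rfl
          · rw [soC_apply_swap M (Sum.inl (lead 0 0)), hr1 _ (by decide), neg_zero]
          · exact soC_apply_self M _
        · obtain rfl : j = 0 := by
            by_contra hne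
            exact hj (by rw [show j = 1 by omega])
          rw [soC_apply_swap M (Sum.inr 0), hr2 _ (by decide), neg_zero]
      · rintro (j | j) hj
        · rcases hlead j with rfl | rfl
          · rw [soC_apply_swap M (Sum.inl (lead 0 0)), hr1 _ (by decide), neg_zero]
          · exact absurd rfl hj
        · obtain rfl | rfl : j = 0 ∨ j = 1 := by omega
          · rw [soC_apply_swap M (Sum.inr 0), hr2 _ (by decide), neg_zero]
          · exact soC_apply_self M _
    · exact isIsolated_of_mem_cent h1 (fun l hl => by
        obtain rfl : l = 0 := by omega
        exact h01.symm) hM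

/-- Every nonzero semisimple element of `𝔭` has a model. -/
theorem hasModel_of_isSemisimple {n : ℕ} {X : soC (n + 2) 2} (hX : X ∈ pPart (soInv (n + 2) 2))
    (hX0 : X ≠ 0) (hss : IsSemisimpleElement X) : HasModel X := by
  obtain ⟨d, g, hg, hJ, hgX, hd, hd0⟩ :=
    exists_normal_form hX (isSemisimple_toLin'_of_ad (by simp) X hss)
  refine HasModel.of_conj hg hJ ?_
  rw [hgX]
  have h0 : d 0 ≠ 0 := by
    intro h0
    refine hX0 (soEmb_injective g hg ?_)
    have hd' : d = 0 := by
      ext k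
      fin_cases k
      · exact h0
      · exact hd0 h0
    rw [hgX, map_zero, hd']
    refine Subtype.ext (Matrix.ext fun i j => ?_)
    rcases i with i | i <;> rcases j with j | j <;> simp [offDiag, normalBlock]
  by_cases h01 : d 0 ^ 2 = d 1 ^ 2
  · exact hasModel_of_eq h0 (hd h01)
  by_cases h1 : n = 0 ∨ d 1 ≠ 0
  · exact hasModel_of_sq_ne h0 h01 h1
  · push Not at h1
    exact hasModel_of_eq_zero (Nat.one_le_iff_ne_zero.2 h1.1) h0 h1.2

end SymPair

theorem proposition3p1 (p : ℕ) (hp : 2 ≤ p) (X : SymPair.soC p 2)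
    (hXp : X ∈ SymPair.pPart (SymPair.soInv p 2)) (hX0 : X ≠ 0)
    (hXss : SymPair.IsSemisimpleElement X)
    (hXreg : ¬ SymPair.IsPRegular (SymPair.soInv p 2) X) :
    ∃ (m : ℕ) (e : SymPair.rAlg (SymPair.soInv p 2) X ≃ₗ⁅ℂ⁆ SymPair.soC m 1),
      ∀ x : SymPair.rAlg (SymPair.soInv p 2) X,
        ((x : SymPair.soC p 2) ∈ SymPair.rPlus (SymPair.soInv p 2) X ↔
          e x ∈ SymPair.kPart (SymPair.soInv m 1)) ∧
        ((x : SymPair.soC p 2) ∈ SymPair.lMinus (SymPair.soInv p 2) X ↔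
          e x ∈ SymPair.pPart (SymPair.soInv m 1)) := by
  obtain ⟨n, rfl⟩ := Nat.exists_eq_add_of_le' hp
  exact (SymPair.hasModel_of_isSemisimple hXp hX0 hXss).exists_equiv
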